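/- **Conventions.** For a set $P$ let $\ell^\infty(P)$ be the Banach space of bounded real functions on $P$ with the sup-norm. For a function $p:P\times P\to[0,1]$ (the transition probabilities) put $p_\rho(\sigma)=p(\rho,\sigma)$. Let $\mathfrak A_{00}(P)\subset\ell^\infty(P)$ be the real linear span of the functions $p_\rho$ ($\rho\in P$), let $\mathfrak A_0(P)$ be its norm closure in $\ell^\infty(P)$, and let $\mathfrak A(P)=\mathfrak A_0(P)^{**}$ be its (real) double dual. An element $F\in\mathfrak A(P)$ is regarded as the bounded function $\rho\mapsto F(\mathrm{ev}_\rho)$ on $P$, where $\mathrm{ev}_\rho\in\mathfrak A_0(P)^*$ is evaluation at $\rho$; this extends the inclusion $\mathfrak A_0(P)\subset\ell^\infty(P)$. **Proposition 3.4.** (1) Let $(\mathcal H_\alpha)_\alpha$ be a family of complex Hilbert spaces and let $P=\bigcup_\alpha\mathbb P\mathcal H_\alpha$ be the disjoint union of their projective spaces, with $p(\rho,\sigma)=|(\Omega_\rho,\Omega_\sigma)|^2$ if $\rho,\sigma$ lie in the same $\mathbb P\mathcal H_\alpha$ and have unit representatives $\Omega_\rho,\Omega_\sigma$, and $p(\rho,\sigma)=0$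 if they lie in different ones. Let $\mathfrak M$ be the self-adjoint part of the von Neumann algebra $\bigoplus_\alpha\mathfrak B(\mathcal H_\alpha)$ of bounded families $A=\oplus_\alpha A_\alpha$, with norm $\sup_\alpha\|A_\alpha\|$, and for $A\in\mathfrak M$ put $\hat A(\rho)=\rho(A_\alpha)=(\Omega_\rho,A_\alpha\Omega_\rho)$ for $\rho\in\mathbb P\mathcal H_\alpha$. Then, as spaces of functions on $P$, $$\mathfrak A(P)=\hat{\mathfrak M}:=\{\hat A: A\in\mathfrak M\},$$ and both identifications, of $\mathfrak A(P)$ with a subspace of $\ell^\infty(P)$ and of $\mathfrak M$ with $\hat{\mathfrak M}$, are isometric. (2) In particular, let $\mathfrak A_{\mathbb C}$ be a unital $C^*$-algebra with self-adjoint part $\mathfrak A$ and pure state space $\mathcal P(\mathfrak A)$, with $p(\rho,\sigma)=|(\Omega_\rho,\Omega_\sigma)|^2$ if the GNS representations of $\rho$ and $\sigma$ are unitarily equivalent, where $\Omega_\rho,\Omega_\sigma$ are unit vectors implementing $\rho$ and $\sigma$ in the same irreducible representation, and $p(\rho,\sigma)=0$ otherwise. Let $\pi_{\rm ra}$ be the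 reduced atomic representation, i.e. the direct sum of the GNS representations of one pure state from each equivalence class, let $\pi_{\rm ra}(\mathfrak A)^-$ be the closure of $\pi_{\rm ra}(\mathfrak A)$ in the weak operator topology, and for $B\in\pi_{\rm ra}(\mathfrak A)^-$ let $\hat B(\rho)=(\Omega_\rho,B\,\Omega_\rho)$, where $\Omega_\rho$ is a unit vector implementing $\rho$ in the summand of $\pi_{\rm ra}$ equivalent to its GNS representation. Then, as spaces of functions on $\mathcal P(\mathfrak A)$, $$\mathfrak A(\mathcal P(\mathfrak A))=\{\hat B: B\in\pi_{\rm ra}(\mathfrak A)^-\},$$ and again the identification of $\mathfrak A(\mathcal P(\mathfrak A))$ with a subspace of $\ell^\infty(\mathcal P(\mathfrak A))$ and the map $B\mapsto\hat B$ are isometric. -/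

import Mathlib

open scoped ENNReal InnerProductSpace ComplexOrder LinearAlgebra.Projectivization

noncomputable section

namespace TransitionProbability

universe u v

/-! ### The function spaces attached to transition probabilities -/

/-- The Banach space of bounded real-valued functions on the set `P`, with the sup-norm. -/
abbrev EllInfty (P : Type u) : Type u := lp (fun _ : P => ℝ) ∞

section Spaces

variable {P : Type u} (p : P → P → unitInterval)

/-- The function `p_ρ`, `p_ρ(σ) = p(ρ, σ)`, as an element of `ℓ^∞(P)`. -/
def kernelFn (ρ : P) : EllInfty P :=
  ⟨fun σ => (p ρ σ : ℝ), memℓp_infty ⟨1, by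
    rintro _ ⟨σ, rfl⟩
    simpa [abs_of_nonneg (p ρ σ).2.1] using (p ρ σ).2.2⟩⟩

/-- `𝔄₀₀(P)`: the finite real linear combinations of the functions `p_ρ`, inside `ℓ^∞(P)`. -/
def A00 : Submodule ℝ (EllInfty P) := Submodule.span ℝ (Set.range (kernelFn p))

/-- `𝔄₀(P)`: the sup-norm closure of `𝔄₀₀(P)` in `ℓ^∞(P)`. -/
def A0 : Submodule ℝ (EllInfty P) := (A00 p).topologicalClosure

/-- `𝔄₀(P)` as a real normed space, with the sup-norm inherited from `ℓ^∞(P)`. -/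
def A0Space : Type u := A0 p

instance : NormedAddCommGroup (A0Space p) := inferInstanceAs (NormedAddCommGroup (A0 p))

instance : NormedSpace ℝ (A0Space p) := inferInstanceAs (NormedSpace ℝ (A0 p))

/-- The inclusion of `𝔄₀(P)` in `ℓ^∞(P)`. -/
def inclusion : A0Space p →ₗᵢ[ℝ] EllInfty P where
  toFun f := (show A0 p from f).1
  map_add' _ _ := rfl
  map_smul' _ _ := rfl
  norm_map' _ := rfl

lemma range_inclusion : Set.range (inclusion p) = closure (A00 p : Set (EllInfty P)) :=
  Subtype.range_coe

/-- `𝔄(P)`: the double dual of the real normed space `𝔄₀(P)`. -/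
abbrev Bidual : Type u := StrongDual ℝ (StrongDual ℝ (A0Space p))

/-- Evaluation at the point `ρ` of `P`, as a continuous linear functional on `𝔄₀(P)`. -/
def evalAt (ρ : P) : StrongDual ℝ (A0Space p) :=
  (lp.evalCLM ℝ (fun _ : P => ℝ) ∞ ρ).comp (inclusion p).toContinuousLinearMap

lemma evalAt_apply (ρ : P) (f : A0Space p) : evalAt p ρ f = inclusion p f ρ := rfl

lemma norm_evalAt_le (ρ : P) : ‖evalAt p ρ‖ ≤ 1 := by
  refine ContinuousLinearMap.opNorm_le_bound _ zero_le_one fun f => ?_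
  rw [evalAt_apply, one_mul, ← (inclusion p).norm_map f]
  exact lp.norm_apply_le_norm ENNReal.top_ne_zero (inclusion p f) ρ

/-- The elements of the double dual `𝔄(P)` regarded as functions on `P`: the function of
`F ∈ 𝔄₀(P)**` is `ρ ↦ F(ev_ρ)`. It extends the inclusion of `𝔄₀(P)` in `ℓ^∞(P)`. -/
def bidualFn : Bidual p →ₗ[ℝ] EllInfty P where
  toFun F := ⟨fun ρ => F (evalAt p ρ), memℓp_infty ⟨‖F‖, by
    rintro _ ⟨ρ, rfl⟩
    simpa using F.le_of_opNorm_le_of_le le_rfl (norm_evalAt_le p ρ)⟩⟩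
  map_add' _ _ := rfl
  map_smul' _ _ := rfl

lemma bidualFn_inclusion (f : A0Space p) :
    bidualFn p (NormedSpace.inclusionInDoubleDual ℝ (A0Space p) f) = inclusion p f := rfl

end Spaces

/-! ### Disjoint unions of projective Hilbert spaces -/

section Projective

/-- The transition probability `|(x, y)|²` of two rays in a Hilbert space, where `x` and `y` are
unit vectors in the rays (written for arbitrary nonzero representatives). -/
def rayProb {H : Type v} [NormedAddCommGroup H] [InnerProductSpace ℂ H] (ρ σ : ℙ ℂ H) :
    unitInterval :=
  ⟨(‖⟪ρ.rep, σ.rep⟫_ℂ‖ / (‖ρ.rep‖ * ‖σ.rep‖)) ^ 2, by positivity,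
    pow_le_one₀ (by positivity) (div_le_one_of_le₀ (norm_inner_le_norm _ _) (by positivity))⟩

/-- The value at `T` of the vector state defined by a ray: `(x, T x)` with `x` a unit vector in
the ray (written for an arbitrary nonzero representative). The real part is taken since only
self-adjoint `T` are relevant. -/
def rayState {H : Type v} [NormedAddCommGroup H] [InnerProductSpace ℂ H] (ρ : ℙ ℂ H)
    (T : H →L[ℂ] H) : ℝ :=
  (⟪ρ.rep, T ρ.rep⟫_ℂ).re / ‖ρ.rep‖ ^ 2

lemma rayProb_mk {H : Type v} [NormedAddCommGroup H] [InnerProductSpace ℂ H] (x y : H)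
    (hx : x ≠ 0) (hy : y ≠ 0) :
    (rayProb (Projectivization.mk ℂ x hx) (Projectivization.mk ℂ y hy) : ℝ) =
      (‖⟪x, y⟫_ℂ‖ / (‖x‖ * ‖y‖)) ^ 2 := by
  obtain ⟨a, ha⟩ := Projectivization.exists_smul_eq_mk_rep ℂ x hx
  obtain ⟨b, hb⟩ := Projectivization.exists_smul_eq_mk_rep ℂ y hy
  have ha0 : ‖(a : ℂ)‖ ≠ 0 := norm_ne_zero_iff.2 a.ne_zero
  have hb0 : ‖(b : ℂ)‖ ≠ 0 := norm_ne_zero_iff.2 b.ne_zero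
  simp only [rayProb, ← ha, ← hb, Units.smul_def, inner_smul_left, inner_smul_right, norm_smul,
    norm_mul, RCLike.norm_conj]
  congr 1
  have h1 : ‖x‖ ≠ 0 := norm_ne_zero_iff.2 hx
  have h2 : ‖y‖ ≠ 0 := norm_ne_zero_iff.2 hy
  field_simp

lemma rayState_mk {H : Type v} [NormedAddCommGroup H] [InnerProductSpace ℂ H] (x : H)
    (hx : x ≠ 0) (T : H →L[ℂ] H) :
    rayState (Projectivization.mk ℂ x hx) T = (⟪x, T x⟫_ℂ).re / ‖x‖ ^ 2 := by
  obtain ⟨a, ha⟩ := Projectivization.exists_smul_eq_mk_rep ℂ x hx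
  have ha0 : ‖(a : ℂ)‖ ≠ 0 := norm_ne_zero_iff.2 a.ne_zero
  have h1 : ‖x‖ ≠ 0 := norm_ne_zero_iff.2 hx
  simp only [rayState, ← ha, Units.smul_def, map_smul, inner_smul_left, inner_smul_right,
    norm_smul]
  rw [← mul_assoc, Complex.mul_conj', ← Complex.ofReal_pow, Complex.re_ofReal_mul]
  field_simp

lemma abs_rayState_le {H : Type v} [NormedAddCommGroup H] [InnerProductSpace ℂ H] (ρ : ℙ ℂ H)
    (T : H →L[ℂ] H) : |rayState ρ T| ≤ ‖T‖ := by
  have h0 : 0 < ‖ρ.rep‖ := norm_pos_iff.2 ρ.rep_nonzero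
  rw [rayState, abs_div, abs_of_pos (by positivity : (0 : ℝ) < ‖ρ.rep‖ ^ 2),
    div_le_iff₀ (by positivity)]
  calc |(⟪ρ.rep, T ρ.rep⟫_ℂ).re| ≤ ‖⟪ρ.rep, T ρ.rep⟫_ℂ‖ := Complex.abs_re_le_norm _
    _ ≤ ‖ρ.rep‖ * ‖T ρ.rep‖ := norm_inner_le_norm _ _
    _ ≤ ‖ρ.rep‖ * (‖T‖ * ‖ρ.rep‖) := by gcongr; exact T.le_opNorm _
    _ = ‖T‖ * ‖ρ.rep‖ ^ 2 := by ring

variable {ι : Type u} (H : ι → Type v) [∀ α, NormedAddCommGroup (H α)]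
  [∀ α, InnerProductSpace ℂ (H α)]

/-- The disjoint union `⋃_α ℙℋ_α` of projective Hilbert spaces. -/
abbrev ProjUnion : Type (max u v) := Σ α, ℙ ℂ (H α)

open Classical in
/-- The transition probabilities on `⋃_α ℙℋ_α`: `|(x, y)|²` for two points of the same `ℙℋ_α`
with unit representatives `x` and `y`, and `0` for points in different `ℙℋ_α`. -/
def projProb (ρ σ : ProjUnion H) : unitInterval :=
  if h : ρ.1 = σ.1 then rayProb (h ▸ ρ.2) σ.2 else 0

lemma projProb_same (α : ι) (ρ σ : ℙ ℂ (H α)) : projProb H ⟨α, ρ⟩ ⟨α, σ⟩ = rayProb ρ σ := by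
  simp [projProb]

/-- The von Neumann algebra `⊕_α 𝔅(ℋ_α)`: the bounded families `(A_α)_α` of bounded operators,
with componentwise operations and the norm `sup_α ‖A_α‖`. -/
abbrev DirectSumB : Type (max u v) := lp (fun α => H α →L[ℂ] H α) ∞

variable [∀ α, CompleteSpace (H α)]

/-- The function `Â` on `⋃_α ℙℋ_α` of a self-adjoint `A = ⊕_α A_α`: `Â(ρ) = ρ(A_α)` for
`ρ ∈ ℙℋ_α`. -/
def hatFn (A : selfAdjoint (DirectSumB H)) : EllInfty (ProjUnion H) :=
  ⟨fun ρ => rayState ρ.2 ((A : DirectSumB H) ρ.1), memℓp_infty ⟨‖A‖, by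
    rintro _ ⟨ρ, rfl⟩
    exact (abs_rayState_le _ _).trans
      (lp.norm_apply_le_norm ENNReal.top_ne_zero (A : DirectSumB H) ρ.1)⟩⟩

end Projective

/-! ### The pure state space of a unital C⋆-algebra -/

section PureStates

variable (A : Type u) [CStarAlgebra A] [PartialOrder A] [StarOrderedRing A]

/-- The state space of a unital C⋆-algebra. -/
def stateSpace : Set (StrongDual ℂ A) :=
  {φ | (∀ a : A, 0 ≤ a → 0 ≤ φ a) ∧ φ 1 = 1}

/-- The pure state space `𝒫(𝔄)`: the extreme points of the state space. -/
abbrev PureState : Type u := {φ : StrongDual ℂ A // φ ∈ (stateSpace A).extremePoints ℝ}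

variable {A}

namespace PureState

/-- A pure state as a positive linear functional. -/
def toPos (ρ : PureState A) : A →ₚ[ℂ] ℂ :=
  PositiveLinearMap.mk₀ ρ.1.toLinearMap ρ.2.1.1

lemma toPos_apply (ρ : PureState A) (a : A) : ρ.toPos a = ρ.1 a := rfl

/-- The Hilbert space `ℋ_ρ` of the GNS representation of `ρ`. -/
abbrev Space (ρ : PureState A) : Type u := ρ.toPos.GNS

/-- The GNS representation `π_ρ`. -/
abbrev rep (ρ : PureState A) : A →⋆ₐ[ℂ] (ρ.Space →L[ℂ] ρ.Space) := ρ.toPos.gnsStarAlgHom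

/-- The cyclic unit vector of the GNS representation of `ρ`, that is, the class of `1`. -/
def cyclic (ρ : PureState A) : ρ.Space := (ρ.toPos.toPreGNS 1 : ρ.toPos.PreGNS)

lemma inner_cyclic (ρ : PureState A) (a : A) : ⟪ρ.cyclic, ρ.rep a ρ.cyclic⟫_ℂ = ρ.1 a := by
  simp [cyclic, PositiveLinearMap.preGNS_inner_def, toPos_apply]

lemma norm_cyclic (ρ : PureState A) : ‖ρ.cyclic‖ = 1 := by
  have h := ρ.inner_cyclic 1
  rw [map_one, ρ.2.1.2] at h
  have h2 : ‖ρ.cyclic‖ ^ 2 = 1 := by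
    have := congrArg Complex.re h
    simpa [← inner_self_eq_norm_sq (𝕜 := ℂ)] using this
  exact (pow_eq_one_iff_of_nonneg (norm_nonneg _) two_ne_zero).1 h2

/-- Two pure states are equivalent when their GNS representations are unitarily equivalent. -/
instance setoid (A : Type u) [CStarAlgebra A] [PartialOrder A] [StarOrderedRing A] :
    Setoid (PureState A) where
  r ρ σ := ∃ U : ρ.Space ≃ₗᵢ[ℂ] σ.Space, ∀ (a : A) (x : ρ.Space), U (ρ.rep a x) = σ.rep a (U x)
  iseqv :=
    { refl := fun ρ => ⟨LinearIsometryEquiv.refl ℂ _, fun _ _ => rfl⟩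
      symm := by
        rintro ρ σ ⟨U, hU⟩
        refine ⟨U.symm, fun a x => U.injective ?_⟩
        rw [hU]; simp
      trans := by
        rintro ρ σ τ ⟨U, hU⟩ ⟨V, hV⟩
        refine ⟨U.trans V, fun a x => ?_⟩
        simp only [LinearIsometryEquiv.trans_apply]
        rw [hU, hV] }

end PureState

open PureState

variable (A)

/-- The set of equivalence classes of pure states, that is, of sectors. -/
abbrev Sector : Type u := Quotient (PureState.setoid A)

variable {A}

/-- The chosen representative of each equivalence class of pure states. -/
def Sector.repr (q : Sector A) : PureState A := Quotient.out q

variable (A)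

/-- The Hilbert space `ℋ_ra` of the reduced atomic representation: the Hilbert space direct sum
of the GNS spaces of one pure state in each equivalence class. -/
abbrev HRa : Type u := lp (fun q : Sector A => q.repr.Space) 2

variable {A}

/-- The reduced atomic representation `π_ra`: the direct sum of the GNS representations of one
pure state in each equivalence class. -/
def reducedAtomic (a : A) : HRa A →L[ℂ] HRa A :=
  LinearMap.mkContinuous
    { toFun := fun x => ⟨fun q => q.repr.rep a (x q),
        ((lp.memℓp x).norm.const_mul ‖a‖).mono fun q => by
          refine ((q.repr.rep a).le_opNorm (x q)).trans ?_
          simpa using mul_le_mul_of_nonneg_right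
            (NonUnitalStarAlgHom.norm_apply_le q.repr.rep a) (norm_nonneg (x q))⟩
      map_add' := fun x y => by ext q : 2; exact map_add _ _ _
      map_smul' := fun c x => by ext q : 2; exact map_smul (q.repr.rep a) c (x q) }
    ‖a‖ fun x => by
      have h : ‖a‖ * ‖x‖ = ‖(‖a‖ : ℂ) • x‖ := by rw [norm_smul]; simp
      rw [h]
      refine lp.norm_mono two_ne_zero fun q => ?_
      refine ((q.repr.rep a).le_opNorm (x q)).trans ?_
      rw [lp.coeFn_smul, Pi.smul_apply, norm_smul]
      simpa using mul_le_mul_of_nonneg_right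
        (NonUnitalStarAlgHom.norm_apply_le q.repr.rep a) (norm_nonneg (x q))

lemma reducedAtomic_apply (a : A) (x : HRa A) (q : Sector A) :
    reducedAtomic a x q = q.repr.rep a (x q) := rfl

lemma exists_intertwiner (ρ : PureState A) :
    ∃ U : ρ.Space ≃ₗᵢ[ℂ] (Sector.repr ⟦ρ⟧).Space,
      ∀ (a : A) (x : ρ.Space), U (ρ.rep a x) = (Sector.repr ⟦ρ⟧).rep a (U x) :=
  (PureState.setoid A).symm (Quotient.mk_out ρ)

open Classical in
/-- A unit vector `Ω_ρ` which implements the pure state `ρ` in the summand of `π_ra` that is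
unitarily equivalent to `π_ρ`: the image of the cyclic vector of `π_ρ` under a unitary
equivalence. -/
def omega (ρ : PureState A) : HRa A :=
  lp.single 2 (⟦ρ⟧ : Sector A) ((exists_intertwiner ρ).choose ρ.cyclic)

lemma norm_omega (ρ : PureState A) : ‖omega ρ‖ = 1 := by
  classical
  rw [omega, lp.norm_single (by norm_num), LinearIsometryEquiv.norm_map, norm_cyclic]

lemma inner_omega (ρ : PureState A) (a : A) :
    ⟪omega ρ, reducedAtomic a (omega ρ)⟫_ℂ = ρ.1 a := by
  classical
  rw [omega, lp.inner_single_left, reducedAtomic_apply, lp.single_apply_self,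
    ← (exists_intertwiner ρ).choose_spec, LinearIsometryEquiv.inner_map_map, inner_cyclic]

open Classical in
/-- The transition probabilities on the pure state space: `p(ρ, σ) = |(Ω_ρ, Ω_σ)|²` if `ρ` and
`σ` are equivalent, where `Ω_ρ` and `Ω_σ` are unit vectors implementing them in the same
irreducible representation, and `p(ρ, σ) = 0` otherwise. -/
def pureProb (ρ σ : PureState A) : unitInterval :=
  if ρ ≈ σ then
    ⟨‖⟪omega ρ, omega σ⟫_ℂ‖ ^ 2, by positivity, pow_le_one₀ (norm_nonneg _) <| by
      simpa [norm_omega] using norm_inner_le_norm (𝕜 := ℂ) (omega ρ) (omega σ)⟩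
  else 0

variable (A)

/-- The weak closure `π_ra(𝔄)⁻` of the image of the self-adjoint part `𝔄` of the C⋆-algebra
under the reduced atomic representation: the closure in the weak operator topology. -/
def raClosure : Set (HRa A →L[ℂ] HRa A) :=
  ContinuousLinearMapWOT.ofCLM ⁻¹' closure
    (Set.range fun a : selfAdjoint A =>
      (ContinuousLinearMapWOT.ofCLM (reducedAtomic (a : A)) : HRa A →WOT[ℂ] HRa A))

variable {A}

/-- The Gelfand transform of an operator `B` on `ℋ_ra`: the function `ρ ↦ (Ω_ρ, B Ω_ρ)` on the
pure state space. For `B = π_ra(a)` with `a` self-adjoint it is `ρ ↦ ρ(a)`. -/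
def gelfandFn (B : HRa A →L[ℂ] HRa A) : EllInfty (PureState A) :=
  ⟨fun ρ => (⟪omega ρ, B (omega ρ)⟫_ℂ).re, memℓp_infty ⟨‖B‖, by
    rintro _ ⟨ρ, rfl⟩
    refine (Complex.abs_re_le_norm _).trans ((norm_inner_le_norm _ _).trans ?_)
    simpa [norm_omega] using B.le_opNorm (omega ρ)⟩⟩

end PureStates

end TransitionProbability

end

/-!
Both parts identify `𝔄(P)` and the operator algebra with the same space of functions on `P`: the
bounded functions `c` on `⋃_α ℙℋ_α` whose homogeneous extensions `x ↦ ‖x‖² c([x])` to the spaces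
`ℋ_α` are quadratic forms (`IsForm`).

*Operators.* By Riesz representation, a bounded form is the function `Â` of a unique self-adjoint
`A` in `⊕_α 𝔅(ℋ_α)`, with the same bound; hence `range_hatFn` and `isometry_hatFn`.

*The double dual.* A transition probability `p_ρ` is the function of a rank one projection. Being a
form is a closed linear condition, so it holds for all of `𝔄₀(P)`; in other words, `ρ ↦ ev_ρ` is a
form with values in `𝔄₀(P)*`, and applying `F ∈ 𝔄₀(P)**` to it shows that the function of `F` is a
form (`isForm_bidualFn`). Conversely, the compressions of a bounded form `f` to finitely many
finite-dimensional subspaces lie in `𝔄₀₀(P)`, by the spectral theorem, are bounded by `‖f‖`, and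
converge to `f` pointwise. A weak-* cluster point of them, which exists by Banach–Alaoglu, is an
element of the double dual of norm at most `‖f‖` with function `f` (`exists_bidualFn_eq`). It
remains to see that `F` is determined by its function (`bidualFn_injective`), that is, that the
evaluations span a norm-dense subspace of `𝔄₀(P)*`. A functional composed with a compression is a
linear combination of evaluations, so it suffices that every `φ ∈ 𝔄₀(P)*` is a norm limit of its
compressions. Suppose that `T ∈ 𝔄₀₀(P)` with `‖T‖ ≤ 1` almost attains the norm of `φ` and is fixed
by a compression. For `g` in the unit ball let `g'` be the part of `g` that the compression
discards. Then `‖T + δ g'‖ ≤ 1 + 2 δ²` (`norm_add_smul_sub_compress_le`), and therefore `φ(g')` is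
small, uniformly in `g`. Injectivity and the norm bound together give the isometry.

*Pure states.* The GNS representation of a pure state is irreducible, and conversely the vector
states of an irreducible representation are pure; by Schur's lemma, two unit vectors give the same
state only if they are proportional. Hence the pure states correspond to the rays of the summands of
the reduced atomic representation (`rayEquiv`), compatibly with the transition probabilities
(`pureProb_eq`). The summands are irreducible and pairwise inequivalent, so the commutant of
the reduced atomic representation consists of families of scalars, and the double commutant theorem
(in the form `exists_norm_rep_sub_lt`) shows that the weak closure of the image of the self-adjoint
elements consists of all self-adjoint block diagonal operators (`raClosure_eq_range`). This reduces
the second part to the first.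
-/

noncomputable section

namespace TransitionProbability

/-! ### Quadratic forms attached to functions on projective spaces -/

section Forms

variable {ι : Type*} {H : ι → Type*} [∀ α, NormedAddCommGroup (H α)]
  [∀ α, InnerProductSpace ℂ (H α)]
  {V W : Type*} [AddCommGroup V] [Module ℝ V] [AddCommGroup W] [Module ℝ W]

open Classical in
/-- The extension of a (vector-valued) function `c` on `⋃_α ℙℋ_α` to a function on each `ℋ_α`
that is homogeneous of degree two, `x ↦ ‖x‖² c([x])`, with value `0` at `0`. -/
def homog (c : ProjUnion H → V) (α : ι) (x : H α) : V :=
  if h : x = 0 then 0 else ‖x‖ ^ 2 • c ⟨α, Projectivization.mk ℂ x h⟩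

/-- The polarization of `homog c`. If `c = Â` then `polar c x y = Re (x, A y)`. -/
def polar (c : ProjUnion H → V) (α : ι) (x y : H α) : V :=
  (1 / 4 : ℝ) • (homog c α (x + y) - homog c α (x - y))

/-- A function on `⋃_α ℙℋ_α` is a form if its homogeneous extension to each `ℋ_α` is a real
quadratic form, that is, if its polarization is real-linear in the first argument. All conditions
are linear and pointwise, hence they are inherited by limits and by linear images. -/
structure IsForm (c : ProjUnion H → V) : Prop where
  add : ∀ (α : ι) (x x' y : H α), polar c α (x + x') y = polar c α x y + polar c α x' y
  smul : ∀ (α : ι) (t : ℝ) (x y : H α), polar c α ((t : ℂ) • x) y = t • polar c α x y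

lemma homog_zero (c : ProjUnion H → V) (α : ι) : homog c α 0 = 0 := by simp [homog]

lemma homog_rep (c : ProjUnion H → V) (ρ : ProjUnion H) :
    homog c ρ.1 ρ.2.rep = ‖ρ.2.rep‖ ^ 2 • c ρ := by
  rw [homog, dif_neg ρ.2.rep_nonzero, Projectivization.mk_rep]

lemma homog_smul (c : ProjUnion H → V) (α : ι) (a : ℂ) (x : H α) :
    homog c α (a • x) = ‖a‖ ^ 2 • homog c α x := by
  by_cases ha : a = 0
  · simp [ha, homog_zero]
  by_cases hx : x = 0
  · simp [hx, homog_zero]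
  have : Projectivization.mk ℂ (a • x) (smul_ne_zero ha hx) = Projectivization.mk ℂ x hx :=
    (Projectivization.mk_eq_mk_iff' ℂ _ _ _ _).2 ⟨a, rfl⟩
  rw [homog, homog, dif_neg (smul_ne_zero ha hx), dif_neg hx, this, smul_smul, norm_smul, mul_pow]

lemma homog_neg (c : ProjUnion H → V) (α : ι) (x : H α) : homog c α (-x) = homog c α x := by
  simpa using homog_smul c α (-1) x

lemma homog_map (L : V →ₗ[ℝ] W) (c : ProjUnion H → V) (α : ι) (x : H α) :
    homog (fun ρ => L (c ρ)) α x = L (homog c α x) := by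
  by_cases hx : x = 0 <;> simp [homog, hx]

lemma polar_map (L : V →ₗ[ℝ] W) (c : ProjUnion H → V) (α : ι) (x y : H α) :
    polar (fun ρ => L (c ρ)) α x y = L (polar c α x y) := by
  simp only [polar, homog_map, map_smul, map_sub]

lemma polar_comm (c : ProjUnion H → V) (α : ι) (x y : H α) : polar c α x y = polar c α y x := by
  rw [polar, polar, add_comm, ← homog_neg c α (x - y), neg_sub]

lemma polar_I_smul (c : ProjUnion H → V) (α : ι) (x y : H α) :
    polar c α (Complex.I • x) (Complex.I • y) = polar c α x y := by
  rw [polar, polar, ← smul_add, ← smul_sub, homog_smul, homog_smul]; simp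

lemma polar_self (c : ProjUnion H → V) (α : ι) (x : H α) : polar c α x x = homog c α x := by
  have : homog c α (x + x) = (4 : ℝ) • homog c α x := by
    rw [← two_smul ℂ x, homog_smul]; norm_num
  rw [polar, sub_self, homog_zero, sub_zero, this, smul_smul]; norm_num

lemma IsForm.map {c : ProjUnion H → V} (hc : IsForm c) (L : V →ₗ[ℝ] W) :
    IsForm fun ρ => L (c ρ) where
  add α x x' y := by simp only [polar_map, hc.add, map_add]
  smul α t x y := by simp only [polar_map, hc.smul, map_smul]

/-- A function which is a form after applying each member of a separating family of linear maps is
a form. -/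
lemma IsForm.of_forall {κ : Type*} {c : ProjUnion H → V} (L : κ → V →ₗ[ℝ] W)
    (hL : ∀ v w, (∀ k, L k v = L k w) → v = w) (h : ∀ k, IsForm fun ρ => L k (c ρ)) :
    IsForm c where
  add α x x' y := hL _ _ fun k => by
    simpa only [polar_map, map_add] using (h k).add α x x' y
  smul α t x y := hL _ _ fun k => by
    simpa only [polar_map, map_smul] using (h k).smul α t x y

lemma abs_homog_le {f : ProjUnion H → ℝ} {M : ℝ} (hM : ∀ ρ, |f ρ| ≤ M) (α : ι) (x : H α) :
    |homog f α x| ≤ M * ‖x‖ ^ 2 := by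
  by_cases hx : x = 0
  · simp [homog, hx]
  · rw [homog, dif_neg hx, smul_eq_mul, abs_mul, abs_of_nonneg (by positivity), mul_comm]
    gcongr
    exact hM _

/-- A bounded form satisfies the Cauchy–Schwarz type estimate with the same constant. -/
lemma IsForm.abs_polar_le {f : ProjUnion H → ℝ} (hf : IsForm f) {M : ℝ} (hM : ∀ ρ, |f ρ| ≤ M)
    (α : ι) (x y : H α) : |polar f α x y| ≤ M * ‖x‖ * ‖y‖ := by
  have hsmul' (t : ℝ) (x y : H α) : polar f α x ((t : ℂ) • y) = t * polar f α x y := by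
    rw [polar_comm, hf.smul, polar_comm, smul_eq_mul]
  by_cases hx : x = 0
  · have := hf.smul α 0 0 y
    simp only [Complex.ofReal_zero, zero_smul] at this
    simp [hx, this]
  by_cases hy : y = 0
  · have := hsmul' 0 x 0
    simp only [Complex.ofReal_zero, zero_smul, zero_mul] at this
    simp [hy, this]
  have hx0 : ‖x‖ ≠ 0 := norm_ne_zero_iff.2 hx
  have hy0 : ‖y‖ ≠ 0 := norm_ne_zero_iff.2 hy
  -- for unit vectors, use the parallelogram law
  have key (u v : H α) (hu : ‖u‖ = 1) (hv : ‖v‖ = 1) : |polar f α u v| ≤ M := by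
    have h1 := abs_homog_le hM α (u + v)
    have h2 := abs_homog_le hM α (u - v)
    have h3 := parallelogram_law_with_norm ℂ u v
    rw [hu, hv] at h3
    rw [polar, smul_eq_mul, abs_mul, abs_of_pos (by norm_num : (0 : ℝ) < 1 / 4)]
    have h4 := abs_sub (homog f α (u + v)) (homog f α (u - v))
    have h5 : M * ‖u + v‖ ^ 2 + M * ‖u - v‖ ^ 2 = 4 * M := by rw [← mul_add, h3]; ring
    linarith
  have hxe : x = ((‖x‖ : ℝ) : ℂ) • (((‖x‖⁻¹ : ℝ) : ℂ) • x) := by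
    rw [smul_smul, ← Complex.ofReal_mul, mul_inv_cancel₀ hx0]; simp
  have hye : y = ((‖y‖ : ℝ) : ℂ) • (((‖y‖⁻¹ : ℝ) : ℂ) • y) := by
    rw [smul_smul, ← Complex.ofReal_mul, mul_inv_cancel₀ hy0]; simp
  have hk := key (((‖x‖⁻¹ : ℝ) : ℂ) • x) (((‖y‖⁻¹ : ℝ) : ℂ) • y)
    (by rw [norm_smul]; simp [hx0]) (by rw [norm_smul]; simp [hy0])
  rw [hxe, hye, hf.smul, hsmul', smul_eq_mul, abs_mul, abs_mul, abs_norm, abs_norm, ← hxe, ← hye]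
  calc _ ≤ ‖x‖ * (‖y‖ * M) := by gcongr
    _ = _ := by ring

/-- A bounded form is implemented by a bounded self-adjoint operator on each Hilbert space, with
the same bound. -/
lemma IsForm.exists_operator [∀ α, CompleteSpace (H α)] {f : ProjUnion H → ℝ} (hf : IsForm f)
    {M : ℝ} (hM0 : 0 ≤ M) (hM : ∀ ρ, |f ρ| ≤ M) (α : ι) :
    ∃ T : H α →L[ℂ] H α, IsSelfAdjoint T ∧ ‖T‖ ≤ M ∧
      ∀ x y, (⟪x, T y⟫_ℂ).re = polar f α x y := by
  have hadd' (x y y' : H α) : polar f α x (y + y') = polar f α x y + polar f α x y' := by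
    rw [polar_comm, hf.add, polar_comm, polar_comm f α y']
  have hsmul' (t : ℝ) (x y : H α) : polar f α x ((t : ℂ) • y) = t * polar f α x y := by
    rw [polar_comm, hf.smul, polar_comm, smul_eq_mul]
  have hneg (x y : H α) : polar f α (-x) y = - polar f α x y := by
    simpa using hf.smul α (-1) x y
  have hI (x y : H α) : polar f α x (Complex.I • y) = - polar f α (Complex.I • x) y := by
    rw [← polar_I_smul, smul_smul, Complex.I_mul_I, neg_one_smul, polar_comm, hneg, polar_comm]
  have hsplit (c : ℂ) (x : H α) :
      c • x = ((c.re : ℝ) : ℂ) • x + ((c.im : ℝ) : ℂ) • (Complex.I • x) := by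
    rw [smul_smul, ← add_smul, Complex.re_add_im]
  have hII (x y : H α) : polar f α (Complex.I • Complex.I • x) y = - polar f α x y := by
    rw [smul_smul, Complex.I_mul_I, neg_one_smul, hneg]
  let s : H α →ₗ⋆[ℂ] H α →ₗ[ℂ] ℂ := LinearMap.mk₂'ₛₗ _ _
    (fun x y => ⟨polar f α x y, polar f α (Complex.I • x) y⟩)
    (fun x x' y => by apply Complex.ext <;> simp [hf.add])
    (fun c x y => by
      rw [smul_comm Complex.I c x, hsplit c x, hsplit c (Complex.I • x)]
      simp only [hf.add, hf.smul, hII]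
      apply Complex.ext <;> simp)
    (fun x y y' => by apply Complex.ext <;> simp [hadd'])
    (fun c x y => by
      rw [hsplit c y]
      simp only [hadd', hsmul', hI, hII]
      apply Complex.ext <;> simp
      ring)
  have hs (x y : H α) : s x y = ⟨polar f α x y, polar f α (Complex.I • x) y⟩ := rfl
  let B : H α →L⋆[ℂ] H α →L[ℂ] ℂ := s.mkContinuous₂ (2 * M) fun x y => by
    refine (Complex.norm_le_abs_re_add_abs_im _).trans ?_
    have h1 := hf.abs_polar_le hM α x y
    have h2 := hf.abs_polar_le hM α (Complex.I • x) y
    rw [norm_smul, Complex.norm_I, one_mul] at h2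
    rw [hs]
    simp only
    linarith
  let T := InnerProductSpace.continuousLinearMapOfBilin B
  have hT (x y : H α) : (⟪T x, y⟫_ℂ).re = polar f α x y := by
    rw [InnerProductSpace.continuousLinearMapOfBilin_apply]; rfl
  have hT' (x y : H α) : (⟪x, T y⟫_ℂ).re = polar f α x y := by
    rw [← inner_conj_symm, Complex.conj_re, hT, polar_comm]
  refine ⟨T, ?_, ?_, hT'⟩
  · rw [ContinuousLinearMap.isSelfAdjoint_iff_isSymmetric]
    intro x y
    apply Complex.ext
    · exact (hT x y).trans (hT' x y).symm
    · have h (z : ℂ) : z.im = (-Complex.I * z).re := by simp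
      rw [h, h]
      have h1 : -Complex.I * ⟪T x, y⟫_ℂ = ⟪T x, -Complex.I • y⟫_ℂ := (inner_smul_right _ _ _).symm
      have h2 : -Complex.I * ⟪x, T y⟫_ℂ = ⟪x, T (-Complex.I • y)⟫_ℂ := by
        rw [map_smul, inner_smul_right]
      exact (congrArg Complex.re h1).trans ((hT _ _).trans ((hT' _ _).symm.trans
        (congrArg Complex.re h2.symm)))
  · refine ContinuousLinearMap.opNorm_le_of_re_inner_le hM0 fun x y hx hy => ?_
    refine (hT x y).le.trans ((le_abs_self _).trans ?_)
    simpa [hx, hy] using hf.abs_polar_le hM α x y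

lemma homog_rayState (T : ∀ α, H α →L[ℂ] H α) (α : ι) (x : H α) :
    homog (fun ρ : ProjUnion H => rayState ρ.2 (T ρ.1)) α x = (⟪x, T α x⟫_ℂ).re := by
  by_cases hx : x = 0
  · simp [homog, hx]
  · have : ‖x‖ ≠ 0 := norm_ne_zero_iff.2 hx
    rw [homog, dif_neg hx, rayState_mk, smul_eq_mul]
    field_simp

lemma polar_rayState (T : ∀ α, H α →L[ℂ] H α) (hT : ∀ α, (T α : H α →ₗ[ℂ] H α).IsSymmetric)
    (α : ι) (x y : H α) :
    polar (fun ρ : ProjUnion H => rayState ρ.2 (T ρ.1)) α x y = (⟪x, T α y⟫_ℂ).re := by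
  have h : (⟪y, T α x⟫_ℂ).re = (⟪x, T α y⟫_ℂ).re := by
    rw [← inner_conj_symm, Complex.conj_re]
    exact congrArg Complex.re (hT α x y)
  rw [polar, homog_rayState, homog_rayState]
  simp only [map_add, map_sub, inner_add_left, inner_add_right, inner_sub_left, inner_sub_right,
    Complex.add_re, Complex.sub_re, smul_eq_mul, h]
  ring

lemma isForm_rayState (T : ∀ α, H α →L[ℂ] H α)
    (hT : ∀ α, (T α : H α →ₗ[ℂ] H α).IsSymmetric) :
    IsForm (fun ρ : ProjUnion H => rayState ρ.2 (T ρ.1)) where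
  add α x x' y := by simp [polar_rayState T hT]
  smul α t x y := by simp [polar_rayState T hT]

end Forms

/-! ### The functions in `𝔄₀(P)` are forms -/

section Transport

variable {ι : Type*} {H : ι → Type*} [∀ α, NormedAddCommGroup (H α)]
  [∀ α, InnerProductSpace ℂ (H α)] {P : Type*} (e : P ≃ ProjUnion H)

/-- The evaluation functionals on `ℓ^∞(P)`, indexed by `⋃_α ℙℋ_α` through an identification `e` of
`P` with that set. -/
def pointEval (ρ : ProjUnion H) : StrongDual ℝ (EllInfty P) :=
  lp.evalCLM ℝ (fun _ : P => ℝ) ∞ (e.symm ρ)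

/-- A bounded function on `P`, as a function on `⋃_α ℙℋ_α`. -/
def pull (f : EllInfty P) (ρ : ProjUnion H) : ℝ := f (e.symm ρ)

lemma abs_pull_le (f : EllInfty P) (ρ : ProjUnion H) : |pull e f ρ| ≤ ‖f‖ :=
  lp.norm_apply_le_norm ENNReal.top_ne_zero f (e.symm ρ)

lemma homog_pull (f : EllInfty P) (α : ι) (x : H α) :
    homog (pull e f) α x = homog (pointEval e) α x f :=
  homog_map (ContinuousLinearMap.apply ℝ ℝ f).toLinearMap (pointEval e) α x

lemma polar_pull (f : EllInfty P) (α : ι) (x y : H α) :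
    polar (pull e f) α x y = polar (pointEval e) α x y f :=
  polar_map (ContinuousLinearMap.apply ℝ ℝ f).toLinearMap (pointEval e) α x y

lemma isForm_pull_iff (f : EllInfty P) : IsForm (pull e f) ↔
    (∀ (α : ι) (x x' y : H α), (polar (pointEval e) α (x + x') y - polar (pointEval e) α x y -
      polar (pointEval e) α x' y) f = 0) ∧
    ∀ (α : ι) (t : ℝ) (x y : H α), (polar (pointEval e) α ((t : ℂ) • x) y -
      t • polar (pointEval e) α x y) f = 0 := by
  constructor
  · rintro ⟨h1, h2⟩
    refine ⟨fun α x x' y => ?_, fun α t x y => ?_⟩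
    · simp only [sub_apply, ← polar_pull, h1]
      ring
    · rw [sub_apply, smul_apply, ← polar_pull, ← polar_pull, h2, sub_self]
  · rintro ⟨h1, h2⟩
    refine ⟨fun α x x' y => ?_, fun α t x y => ?_⟩
    · have := h1 α x x' y
      simp only [sub_apply, ← polar_pull] at this
      linarith
    · have := h2 α t x y
      simp only [sub_apply, smul_apply, ← polar_pull] at this
      linarith

/-- The bounded functions on `P` that are forms, a norm-closed subspace of `ℓ^∞(P)`. -/
def formSubmodule : Submodule ℝ (EllInfty P) where
  carrier := {f | IsForm (pull e f)}
  add_mem' {f g} hf hg := by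
    simp only [Set.mem_ofPred_eq, isForm_pull_iff, map_add] at *
    exact ⟨fun α x x' y => by rw [hf.1, hg.1, add_zero], fun α t x y => by
      rw [hf.2, hg.2, add_zero]⟩
  zero_mem' := by
    simp only [Set.mem_ofPred_eq, isForm_pull_iff, map_zero, implies_true, and_self]
  smul_mem' c f hf := by
    simp only [Set.mem_ofPred_eq, isForm_pull_iff, map_smul] at *
    exact ⟨fun α x x' y => by rw [hf.1, smul_zero], fun α t x y => by rw [hf.2, smul_zero]⟩

lemma isClosed_formSubmodule : IsClosed (formSubmodule e : Set (EllInfty P)) := by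
  have : (formSubmodule e : Set (EllInfty P)) = {f | IsForm (pull e f)} := rfl
  rw [this]
  simp only [isForm_pull_iff, Set.ofPred_and, Set.ofPred_forall]
  refine IsClosed.inter ?_ ?_
  · exact isClosed_iInter fun α => isClosed_iInter fun x => isClosed_iInter fun x' =>
      isClosed_iInter fun y => isClosed_eq (ContinuousLinearMap.continuous _) continuous_const
  · exact isClosed_iInter fun α => isClosed_iInter fun t => isClosed_iInter fun x =>
      isClosed_iInter fun y => isClosed_eq (ContinuousLinearMap.continuous _) continuous_const

lemma homog_projProb (ρ : ProjUnion H) (x : H ρ.1) :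
    homog (fun σ => (projProb H ρ σ : ℝ)) ρ.1 x = ‖⟪ρ.2.rep, x⟫_ℂ‖ ^ 2 / ‖ρ.2.rep‖ ^ 2 := by
  by_cases hx : x = 0
  · simp [homog, hx]
  · have h1 : ‖x‖ ≠ 0 := norm_ne_zero_iff.2 hx
    have h2 : ‖ρ.2.rep‖ ≠ 0 := norm_ne_zero_iff.2 ρ.2.rep_nonzero
    rw [homog, dif_neg hx, projProb_same, smul_eq_mul]
    conv_lhs => rw [← Projectivization.mk_rep ρ.2]
    rw [rayProb_mk _ _ ρ.2.rep_nonzero]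
    field_simp

lemma homog_projProb_ne (ρ : ProjUnion H) {α : ι} (hα : α ≠ ρ.1) (x : H α) :
    homog (fun σ => (projProb H ρ σ : ℝ)) α x = 0 := by
  by_cases hx : x = 0
  · simp [homog, hx]
  · simp [homog, hx, projProb, hα.symm]

/-- The transition probabilities from `ρ` are the expectation values of the rank one projection
onto `ρ`, hence form a quadratic form. -/
lemma isForm_projProb (ρ : ProjUnion H) : IsForm fun σ => (projProb H ρ σ : ℝ) := by
  have hpol (x y : H ρ.1) : polar (fun σ => (projProb H ρ σ : ℝ)) ρ.1 x y =
      (⟪x, ρ.2.rep⟫_ℂ * ⟪ρ.2.rep, y⟫_ℂ).re / ‖ρ.2.rep‖ ^ 2 := by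
    rw [polar, homog_projProb, homog_projProb, ← inner_conj_symm x]
    simp only [inner_add_right, inner_sub_right, ← Complex.normSq_eq_norm_sq, Complex.normSq_apply,
      Complex.add_re, Complex.add_im, Complex.sub_re, Complex.sub_im, Complex.mul_re,
      Complex.conj_re, Complex.conj_im, smul_eq_mul]
    ring
  have hne {α : ι} (hα : α ≠ ρ.1) (x y : H α) :
      polar (fun σ => (projProb H ρ σ : ℝ)) α x y = 0 := by
    rw [polar, homog_projProb_ne ρ hα, homog_projProb_ne ρ hα]; simp
  refine ⟨fun α x x' y => ?_, fun α t x y => ?_⟩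
  · by_cases hα : α = ρ.1
    · subst hα
      simp only [hpol, inner_add_left, add_mul, Complex.add_re, add_div]
    · simp [hne hα]
  · by_cases hα : α = ρ.1
    · subst hα
      simp only [hpol, inner_smul_left, Complex.conj_ofReal, mul_assoc, Complex.re_ofReal_mul,
        smul_eq_mul, mul_div_assoc]
    · simp [hne hα]

variable {e} {p : P → P → unitInterval}

lemma pull_kernelFn (hp : ∀ ρ σ, p ρ σ = projProb H (e ρ) (e σ)) (ρ : P) :
    pull e (kernelFn p ρ) = fun σ => (projProb H (e ρ) σ : ℝ) := by
  funext σ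
  change (p ρ (e.symm σ) : ℝ) = _
  rw [hp, Equiv.apply_symm_apply]

lemma A0_le_formSubmodule (hp : ∀ ρ σ, p ρ σ = projProb H (e ρ) (e σ)) :
    A0 p ≤ formSubmodule e := by
  refine Submodule.topologicalClosure_minimal _ (Submodule.span_le.2 ?_)
    (isClosed_formSubmodule e)
  rintro _ ⟨ρ, rfl⟩
  change IsForm (pull e (kernelFn p ρ))
  rw [pull_kernelFn hp]
  exact isForm_projProb _

lemma isForm_inclusion (hp : ∀ ρ σ, p ρ σ = projProb H (e ρ) (e σ)) (g : A0Space p) :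
    IsForm (pull e (inclusion p g)) :=
  A0_le_formSubmodule hp (show A0 p from g).2

/-- The evaluations at points form a quadratic form with values in `𝔄₀(P)*`. -/
lemma isForm_evalAt (hp : ∀ ρ σ, p ρ σ = projProb H (e ρ) (e σ)) :
    IsForm fun ρ => evalAt p (e.symm ρ) :=
  IsForm.of_forall (fun g : A0Space p => (ContinuousLinearMap.apply ℝ ℝ g).toLinearMap)
    (fun _ _ h => ContinuousLinearMap.ext h) fun g => isForm_inclusion hp g

/-- The function on `P` of an element of the double dual is a form. -/
lemma isForm_bidualFn (hp : ∀ ρ σ, p ρ σ = projProb H (e ρ) (e σ)) (F : Bidual p) :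
    IsForm (pull e (bidualFn p F)) :=
  (isForm_evalAt hp).map F.toLinearMap

end Transport

/-! ### Finite-dimensional compressions -/

/-- The compression of a symmetric operator to a finite-dimensional subspace is a real linear
combination of rank one projections. -/
lemma exists_inner_starProjection_eq_sum {E : Type*} [NormedAddCommGroup E]
    [InnerProductSpace ℂ E] (K : Submodule ℂ E) [FiniteDimensional ℂ K] {T : E →L[ℂ] E}
    (hT : (T : E →ₗ[ℂ] E).IsSymmetric) :
    ∃ (n : ℕ) (v : Fin n → E) (c : Fin n → ℝ), (∀ i, ‖v i‖ = 1) ∧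
      ∀ x, (⟪K.starProjection x, T (K.starProjection x)⟫_ℂ).re =
        ∑ i, c i * ‖⟪v i, x⟫_ℂ‖ ^ 2 := by
  let S : K →ₗ[ℂ] K := (K.orthogonalProjectionOnto ∘L T ∘L K.subtypeL : K →L[ℂ] K)
  have hS : S.IsSymmetric := fun x y => by
    change ⟪K.orthogonalProjectionOnto (T x), y⟫_ℂ = ⟪x, K.orthogonalProjectionOnto (T y)⟫_ℂ
    rw [Submodule.inner_orthogonalProjectionOnto_eq_of_mem_right,
      Submodule.inner_orthogonalProjectionOnto_eq_of_mem_left]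
    exact hT _ _
  let b := hS.eigenvectorBasis rfl
  refine ⟨_, fun i => (b i : E), hS.eigenvalues rfl, fun i => b.orthonormal.1 i, fun x => ?_⟩
  have h1 : ⟪K.starProjection x, T (K.starProjection x)⟫_ℂ =
      ⟪K.orthogonalProjectionOnto x, S (K.orthogonalProjectionOnto x)⟫_ℂ := by
    change _ = ⟪K.orthogonalProjectionOnto x,
      K.orthogonalProjectionOnto (T (K.orthogonalProjectionOnto x))⟫_ℂ
    rw [Submodule.inner_orthogonalProjectionOnto_eq_of_mem_left]
    rfl
  rw [h1, ← b.sum_inner_mul_inner, Complex.re_sum]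
  refine Finset.sum_congr rfl fun i _ => ?_
  rw [← hS, hS.apply_eigenvectorBasis, inner_smul_left, ← inner_conj_symm _ (b i)]
  change (_ * (_ * ⟪b i, _⟫_ℂ)).re = _
  rw [mul_left_comm, Complex.conj_mul', Submodule.inner_orthogonalProjectionOnto_eq_of_mem_left]
  have : (starRingEnd ℂ) ((hS.eigenvalues rfl i : ℝ) : ℂ) = ((hS.eigenvalues rfl i : ℝ) : ℂ) :=
    Complex.conj_ofReal _
  erw [this]
  rw [← Complex.ofReal_pow, ← Complex.ofReal_mul, Complex.ofReal_re]

section Compress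

variable {ι : Type*} {H : ι → Type*}

open Classical in
/-- The vectors of `ℋ_α` in a finite set of vectors in the disjoint union of the Hilbert spaces. -/
def fiber (S : Finset (Σ α, H α)) (α : ι) : Finset (H α) :=
  S.preimage (Sigma.mk α) sigma_mk_injective.injOn

lemma mem_fiber {S : Finset (Σ α, H α)} {α : ι} {x : H α} : x ∈ fiber S α ↔ ⟨α, x⟩ ∈ S := by
  simp [fiber]

variable [∀ α, NormedAddCommGroup (H α)] [∀ α, InnerProductSpace ℂ (H α)]

/-- The linear span in `ℋ_α` of the vectors in `S`. -/
abbrev spanAt (S : Finset (Σ α, H α)) (α : ι) : Submodule ℂ (H α) :=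
  Submodule.span ℂ (fiber S α : Set (H α))

lemma starProjection_spanAt_eq_zero {S : Finset (Σ α, H α)} {α : ι} (h : ∀ x : H α, ⟨α, x⟩ ∉ S)
    (x : H α) : (spanAt S α).starProjection x = 0 := by
  have h1 : fiber S α = ∅ := Finset.eq_empty_of_forall_notMem fun x hx => h x (mem_fiber.1 hx)
  have h2 : spanAt S α = ⊥ := by simp [spanAt, h1]
  exact (Submodule.mem_bot ℂ).1 (h2.le (Submodule.starProjection_apply_mem _ _))

variable {P : Type*} (e : P ≃ ProjUnion H)

/-- The compression `f ↦ f_S` of functions by the orthogonal projections `E_α` onto the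
finite-dimensional spaces `spanAt S α`: the function of `A` is mapped to that of `⊕_α E_α A_α E_α`.
-/
def compress (S : Finset (Σ α, H α)) : EllInfty P →ₗ[ℝ] EllInfty P where
  toFun f := ⟨fun ρ => homog (pull e f) (e ρ).1 ((spanAt S (e ρ).1).starProjection (e ρ).2.rep) /
      ‖(e ρ).2.rep‖ ^ 2, memℓp_infty ⟨‖f‖, by
    rintro _ ⟨ρ, rfl⟩
    have h0 : 0 < ‖(e ρ).2.rep‖ := norm_pos_iff.2 (e ρ).2.rep_nonzero
    simp only [Real.norm_eq_abs, abs_div, abs_pow, abs_norm]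
    rw [div_le_iff₀ (by positivity)]
    refine (abs_homog_le (abs_pull_le e f) _ _).trans ?_
    gcongr
    exact Submodule.norm_starProjection_apply_le _ _⟩⟩
  map_add' f g := by
    ext ρ
    simp only [homog_pull, map_add, add_div]
    rfl
  map_smul' c f := by
    ext ρ
    simp only [homog_pull, map_smul, smul_eq_mul, mul_div_assoc]
    rfl

lemma compress_apply (S : Finset (Σ α, H α)) (f : EllInfty P) (ρ : P) : compress e S f ρ =
    homog (pull e f) (e ρ).1 ((spanAt S (e ρ).1).starProjection (e ρ).2.rep) /
      ‖(e ρ).2.rep‖ ^ 2 := rfl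

lemma eq_homog_div (f : EllInfty P) (ρ : P) :
    f ρ = homog (pull e f) (e ρ).1 (e ρ).2.rep / ‖(e ρ).2.rep‖ ^ 2 := by
  have h0 : ‖(e ρ).2.rep‖ ≠ 0 := norm_ne_zero_iff.2 (e ρ).2.rep_nonzero
  rw [homog_rep, pull, Equiv.symm_apply_apply, smul_eq_mul]
  field_simp

lemma norm_compress_le (S : Finset (Σ α, H α)) (f : EllInfty P) : ‖compress e S f‖ ≤ ‖f‖ := by
  refine lp.norm_le_of_forall_le (norm_nonneg _) fun ρ => ?_
  have h0 : 0 < ‖(e ρ).2.rep‖ := norm_pos_iff.2 (e ρ).2.rep_nonzero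
  rw [compress_apply, Real.norm_eq_abs, abs_div, abs_pow, abs_norm, div_le_iff₀ (by positivity)]
  refine (abs_homog_le (abs_pull_le e f) _ _).trans ?_
  gcongr
  exact Submodule.norm_starProjection_apply_le _ _

lemma compress_apply_of_mem {S : Finset (Σ α, H α)} (f : EllInfty P) {ρ : P}
    (h : ⟨(e ρ).1, (e ρ).2.rep⟩ ∈ S) : compress e S f ρ = f ρ := by
  rw [compress_apply, eq_homog_div e f ρ,
    Submodule.starProjection_eq_self_iff.2 (Submodule.subset_span (mem_fiber.2 h))]

variable {e} {p : P → P → unitInterval}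

lemma compress_kernelFn (hp : ∀ ρ σ, p ρ σ = projProb H (e ρ) (e σ)) {S : Finset (Σ α, H α)}
    {ρ : P} (h : ⟨(e ρ).1, (e ρ).2.rep⟩ ∈ S) :
    compress e S (kernelFn p ρ) = kernelFn p ρ := by
  ext σ
  rw [compress_apply, eq_homog_div e (kernelFn p ρ) σ, pull_kernelFn hp]
  congr 1
  generalize (e σ).2.rep = x
  generalize (e σ).1 = α at x
  by_cases hα : α = (e ρ).1
  · subst hα
    rw [homog_projProb, homog_projProb, ← Submodule.inner_starProjection_left_eq_right,
      Submodule.starProjection_eq_self_iff.2 (Submodule.subset_span (mem_fiber.2 h))]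
  · rw [homog_projProb_ne _ hα, homog_projProb_ne _ hα]

open Filter in
lemma eventually_compress_eq (hp : ∀ ρ σ, p ρ σ = projProb H (e ρ) (e σ)) {f : EllInfty P}
    (hf : f ∈ A00 p) : ∀ᶠ S in atTop, compress e S f = f := by
  induction hf using Submodule.span_induction with
  | mem f hf =>
    obtain ⟨ρ, rfl⟩ := hf
    filter_upwards [eventually_ge_atTop {⟨(e ρ).1, (e ρ).2.rep⟩}] with S hS
    exact compress_kernelFn hp (Finset.singleton_subset_iff.1 hS)
  | zero => simp
  | add f g _ _ hf hg =>
    filter_upwards [hf, hg] with S h1 h2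
    rw [map_add, h1, h2]
  | smul c f _ hf =>
    filter_upwards [hf] with S h1
    rw [map_smul, h1]

variable [∀ α, CompleteSpace (H α)]

/-- Compressions of forms lie in `𝔄₀₀(P)`, by the spectral theorem in finite dimension. -/
lemma compress_mem_A00 (hp : ∀ ρ σ, p ρ σ = projProb H (e ρ) (e σ)) (S : Finset (Σ α, H α))
    {f : EllInfty P} (hf : IsForm (pull e f)) : compress e S f ∈ A00 p := by
  classical
  choose T hTsa hTn hT using hf.exists_operator (norm_nonneg f) (abs_pull_le e f)
  choose n v c hv hc using fun α => exists_inner_starProjection_eq_sum (spanAt S α)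
    (ContinuousLinearMap.isSelfAdjoint_iff_isSymmetric.1 (hTsa α))
  have hv0 (α : ι) (i : Fin (n α)) : v α i ≠ 0 := norm_ne_zero_iff.1 (by rw [hv]; exact one_ne_zero)
  have key : compress e S f = ∑ α ∈ S.image Sigma.fst, ∑ i : Fin (n α),
      c α i • kernelFn p (e.symm ⟨α, Projectivization.mk ℂ (v α i) (hv0 α i)⟩) := by
    ext ρ
    have h0 : ‖(e ρ).2.rep‖ ≠ 0 := norm_ne_zero_iff.2 (e ρ).2.rep_nonzero
    have hk (α : ι) (i : Fin (n α)) :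
        kernelFn p (e.symm ⟨α, Projectivization.mk ℂ (v α i) (hv0 α i)⟩) ρ =
          (projProb H ⟨α, Projectivization.mk ℂ (v α i) (hv0 α i)⟩ (e ρ) : ℝ) := by
      change (p _ ρ : ℝ) = _
      rw [hp, Equiv.apply_symm_apply]
    have hzero (α : ι) (hα : α ≠ (e ρ).1) (i : Fin (n α)) :
        (projProb H ⟨α, Projectivization.mk ℂ (v α i) (hv0 α i)⟩ (e ρ) : ℝ) = 0 := by
      simp [projProb, hα]
    have hsame (i : Fin (n (e ρ).1)) :
        (projProb H ⟨(e ρ).1, Projectivization.mk ℂ (v _ i) (hv0 _ i)⟩ (e ρ) : ℝ) =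
          ‖⟪v _ i, (e ρ).2.rep⟫_ℂ‖ ^ 2 / ‖(e ρ).2.rep‖ ^ 2 := by
      refine (congrArg Subtype.val (projProb_same H _ _ (e ρ).2)).trans ?_
      conv_lhs => rw [← Projectivization.mk_rep (e ρ).2]
      rw [rayProb_mk _ _ _ (e ρ).2.rep_nonzero, hv, one_mul, div_pow]
    have hcoe : (∑ α ∈ S.image Sigma.fst, ∑ i : Fin (n α),
        c α i • kernelFn p (e.symm ⟨α, Projectivization.mk ℂ (v α i) (hv0 α i)⟩) : EllInfty P) ρ =
        ∑ α ∈ S.image Sigma.fst, ∑ i : Fin (n α), c α i *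
          (projProb H ⟨α, Projectivization.mk ℂ (v α i) (hv0 α i)⟩ (e ρ) : ℝ) := by
      simp only [← hk]
      change lp.evalCLM ℝ (fun _ : P => ℝ) ∞ ρ _ = _
      simp only [map_sum, map_smul]
      rfl
    rw [hcoe, compress_apply, ← polar_self, ← hT, hc, Finset.sum_div]
    by_cases hmem : (e ρ).1 ∈ S.image Sigma.fst
    · rw [Finset.sum_eq_single_of_mem _ hmem
        (fun α _ hα => Finset.sum_eq_zero fun i _ => by rw [hzero α hα, mul_zero])]
      exact Finset.sum_congr rfl fun i _ => by rw [hsame, mul_div_assoc]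
    · rw [Finset.sum_eq_zero (s := S.image Sigma.fst) fun α hα => Finset.sum_eq_zero fun i _ => by
        rw [hzero α (fun h => hmem (h ▸ hα)), mul_zero]]
      -- the compression vanishes in the components that do not meet `S`
      rw [← Finset.sum_div, ← hc,
        starProjection_spanAt_eq_zero fun x hx => hmem (Finset.mem_image_of_mem _ hx)]
      simp
  rw [key]
  exact Submodule.sum_mem _ fun α _ => Submodule.sum_mem _ fun i _ =>
    Submodule.smul_mem _ _ (Submodule.subset_span ⟨_, rfl⟩)

end Compress

/-! ### The double dual of `𝔄₀(P)` -/

section Bidual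

variable {ι : Type*} {H : ι → Type*} [∀ α, NormedAddCommGroup (H α)]
  [∀ α, InnerProductSpace ℂ (H α)] {P : Type*} {e : P ≃ ProjUnion H}
  {p : P → P → unitInterval}

/-- An element of the subspace `𝔄₀(P)` of `ℓ^∞(P)` as an element of the normed space `𝔄₀(P)`. -/
def ofA0 (f : EllInfty P) (hf : f ∈ A0 p) : A0Space p := (⟨f, hf⟩ : A0 p)

lemma A00_le_A0 : A00 p ≤ A0 p := Submodule.le_topologicalClosure _

lemma inclusion_ofA0 (f : EllInfty P) (hf : f ∈ A0 p) : inclusion p (ofA0 f hf) = f := rfl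

lemma inclusion_injective : Function.Injective (inclusion p) := (inclusion p).injective

lemma norm_inclusion (g : A0Space p) : ‖inclusion p g‖ = ‖g‖ := (inclusion p).norm_map g

lemma dense_inclusion_mem_A00 : Dense {g : A0Space p | inclusion p g ∈ A00 p} := by
  intro g
  rw [(inclusion p).isometry.isUniformInducing.isInducing.closure_eq_preimage_closure_image]
  have h : inclusion p '' {g : A0Space p | inclusion p g ∈ A00 p} = A00 p := by
    ext f
    constructor
    · rintro ⟨g, hg, rfl⟩
      exact hg
    · exact fun hf => ⟨ofA0 f (A00_le_A0 hf), hf, rfl⟩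
  rw [h, Set.mem_preimage, ← range_inclusion]
  exact ⟨g, rfl⟩

lemma IsForm.homog_add {f : ProjUnion H → ℝ} (hf : IsForm f) (α : ι) (u v : H α) :
    homog f α (u + v) = homog f α u + 2 * polar f α u v + homog f α v := by
  rw [← polar_self, hf.add, polar_comm, hf.add, polar_comm f α v (u + v), hf.add, polar_self,
    polar_self, polar_comm f α v u]
  ring

variable [∀ α, CompleteSpace (H α)]

/-- The restriction of `compress` to `𝔄₀(P)`. -/
def compressA0 (hp : ∀ ρ σ, p ρ σ = projProb H (e ρ) (e σ)) (S : Finset (Σ α, H α)) :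
    A0Space p →L[ℝ] A0Space p :=
  LinearMap.mkContinuous
    { toFun := fun g => ofA0 (compress e S (inclusion p g)) (A00_le_A0
        (compress_mem_A00 hp S (isForm_inclusion hp g)))
      map_add' := fun f g => inclusion_injective (by
        refine Eq.trans ?_ (map_add (inclusion p) _ _).symm
        rw [inclusion_ofA0, inclusion_ofA0, inclusion_ofA0, ← map_add, ← map_add])
      map_smul' := fun c g => inclusion_injective (by
        refine Eq.trans ?_ (map_smul (inclusion p) _ _).symm
        rw [inclusion_ofA0, inclusion_ofA0, RingHom.id_apply, ← map_smul, ← map_smul]) }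
    1 fun g => by
      rw [← norm_inclusion, one_mul, ← norm_inclusion g]
      exact norm_compress_le e S _

lemma inclusion_compressA0 (hp : ∀ ρ σ, p ρ σ = projProb H (e ρ) (e σ))
    (S : Finset (Σ α, H α)) (g : A0Space p) :
    inclusion p (compressA0 hp S g) = compress e S (inclusion p g) := rfl

open Filter Topology in
/-- Every form is the function of an element of the double dual with at most the same norm, namely
of a weak-* cluster point of its compressions. -/
lemma exists_bidualFn_eq (hp : ∀ ρ σ, p ρ σ = projProb H (e ρ) (e σ)) {f : EllInfty P}
    (hf : IsForm (pull e f)) : ∃ F : Bidual p, ‖F‖ ≤ ‖f‖ ∧ bidualFn p F = f := by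
  let u (S : Finset (Σ α, H α)) : A0Space p :=
    ofA0 (compress e S f) (A00_le_A0 (compress_mem_A00 hp S hf))
  let J := NormedSpace.inclusionInDoubleDual ℝ (A0Space p)
  have hball : ∀ S, StrongDual.toWeakDual (J (u S)) ∈
      WeakDual.toStrongDual ⁻¹' Metric.closedBall (0 : Bidual p) ‖f‖ := fun S => by
    refine (mem_closedBall_zero_iff (E := Bidual p)).2 ?_
    refine (NormedSpace.double_dual_bound ℝ (A0Space p) (u S)).trans ?_
    rw [← norm_inclusion]
    exact norm_compress_le e S f
  obtain ⟨F, hF, hcl⟩ := (WeakDual.isCompact_closedBall (0 : Bidual p) ‖f‖).exists_mapClusterPt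
    (f := atTop) (u := fun S => StrongDual.toWeakDual (J (u S)))
    (map_le_iff_le_comap.2 (le_principal_iff.2 (Eventually.of_forall hball) |>.trans
      comap_principal.ge))
  obtain ⟨U, hU, hlim⟩ := mapClusterPt_iff_ultrafilter.1 hcl
  refine ⟨WeakDual.toStrongDual F, by simpa using hF, ?_⟩
  ext ρ
  have h1 : Tendsto (fun S => u S |> evalAt p ρ) U (𝓝 (F (evalAt p ρ))) :=
    ((WeakDual.eval_continuous (evalAt p ρ)).tendsto F).comp hlim
  have h2 : Tendsto (fun S => u S |> evalAt p ρ) U (𝓝 (f ρ)) := by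
    refine tendsto_const_nhds.congr' ?_
    have hev : ∀ᶠ S : Finset (Σ α, H α) in U, {⟨(e ρ).1, (e ρ).2.rep⟩} ⊆ S :=
      hU (eventually_ge_atTop _)
    filter_upwards [hev] with S hS
    exact (compress_apply_of_mem e f (Finset.singleton_subset_iff.1 hS)).symm
  exact tendsto_nhds_unique h1 h2

omit [∀ α, CompleteSpace (H α)] in
/-- The key estimate: if `T` is fixed by the compression, the part of `g` that the compression
discards is almost orthogonal to `T`, so that adding a small multiple of it to `T` increases the
norm to second order only. -/
lemma norm_add_smul_sub_compress_le {S : Finset (Σ α, H α)} {f g : EllInfty P}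
    (hf : ‖f‖ ≤ 1) (hfS : compress e S f = f) (hg : IsForm (pull e g)) (hg1 : ‖g‖ ≤ 1) {δ : ℝ}
    (hδ : 0 ≤ δ) (hδ2 : δ ≤ 1 / 2) : ‖f + δ • (g - compress e S g)‖ ≤ 1 + 2 * δ ^ 2 := by
  refine lp.norm_le_of_forall_le (by positivity) fun ρ => ?_
  have h0 : 0 < ‖(e ρ).2.rep‖ := norm_pos_iff.2 (e ρ).2.rep_nonzero
  have hval : (f + δ • (g - compress e S g)) ρ =
      compress e S f ρ + δ * (g ρ - compress e S g ρ) := by rw [hfS]; rfl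
  rw [hval, compress_apply, compress_apply, eq_homog_div e g ρ]
  generalize (e ρ).2.rep = x at h0 ⊢
  set u := (spanAt S (e ρ).1).starProjection x with hu
  set v := x - u with hv
  have hx : x = u + v := by rw [hv]; abel
  have hpyth : ‖x‖ ^ 2 = ‖u‖ ^ 2 + ‖v‖ ^ 2 := by
    have := Submodule.norm_sq_eq_add_norm_sq_starProjection x (spanAt S (e ρ).1)
    rwa [Submodule.starProjection_orthogonal_val] at this
  have h1 : |homog (pull e f) (e ρ).1 u| ≤ ‖u‖ ^ 2 := by
    refine (abs_homog_le (abs_pull_le e f) _ _).trans ?_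
    nlinarith [sq_nonneg ‖u‖]
  have hgb : ∀ ρ, |pull e g ρ| ≤ 1 := fun ρ => (abs_pull_le e g ρ).trans hg1
  have h2 := hg.abs_polar_le hgb (e ρ).1 u v
  have h3 := abs_homog_le hgb (e ρ).1 v
  have h4 : homog (pull e g) (e ρ).1 x - homog (pull e g) (e ρ).1 u =
      2 * polar (pull e g) (e ρ).1 u v + homog (pull e g) (e ρ).1 v := by
    rw [hx, hg.homog_add]; ring
  rw [← sub_div, h4, Real.norm_eq_abs, ← mul_div_assoc, ← add_div, abs_div, abs_pow, abs_norm,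
    div_le_iff₀ (by positivity), hpyth, abs_le]
  rw [abs_le] at h1 h2 h3
  have h5 : 0 ≤ δ * (‖u‖ * ‖v‖) := by positivity
  have h6 : 2 * (δ * (‖u‖ * ‖v‖)) ≤ 2 * δ ^ 2 * ‖u‖ ^ 2 + ‖v‖ ^ 2 / 2 := by
    nlinarith [sq_nonneg (2 * δ * ‖u‖ - ‖v‖)]
  have h7 : δ * ‖v‖ ^ 2 ≤ 1 / 2 * ‖v‖ ^ 2 := by gcongr
  have h8 : 0 ≤ δ ^ 2 * ‖v‖ ^ 2 := by positivity
  constructor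
  · nlinarith [mul_le_mul_of_nonneg_left h2.1 hδ, mul_le_mul_of_nonneg_left h3.1 hδ]
  · nlinarith [mul_le_mul_of_nonneg_left h2.2 hδ, mul_le_mul_of_nonneg_left h3.2 hδ]

/-- Every continuous functional on `𝔄₀(P)` is a norm limit of its compressions. -/
lemma exists_norm_sub_comp_compressA0_le (hp : ∀ ρ σ, p ρ σ = projProb H (e ρ) (e σ))
    (φ : StrongDual ℝ (A0Space p)) {ε : ℝ} (hε : 0 < ε) :
    ∃ S, ‖φ - φ.comp (compressA0 hp S)‖ ≤ ε := by
  have hN : 0 < 1 + 2 * ‖φ‖ := by positivity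
  obtain ⟨δ, hδ, hδ2, hδε⟩ : ∃ δ : ℝ, 0 < δ ∧ δ ≤ 1 / 2 ∧ δ * (1 + 2 * ‖φ‖) ≤ ε :=
    ⟨min (1 / 2) (ε / (1 + 2 * ‖φ‖)), by positivity, min_le_left _ _,
      (le_div_iff₀ hN).1 (min_le_right _ _)⟩
  -- an element of `𝔄₀₀(P)` in the unit ball at which `φ` almost attains its norm
  obtain ⟨T, hT0, hT1, hTφ⟩ : ∃ T : A0Space p,
      inclusion p T ∈ A00 p ∧ ‖T‖ < 1 ∧ ‖φ‖ - δ ^ 2 < φ T := by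
    have hopen : IsOpen {T : A0Space p | ‖T‖ < 1 ∧ ‖φ‖ - δ ^ 2 < φ T} :=
      (isOpen_lt continuous_norm continuous_const).inter (isOpen_lt continuous_const φ.continuous)
    obtain ⟨T, hT, hT'⟩ := φ.exists_lt_apply_of_lt_opNorm
      (show ‖φ‖ - δ ^ 2 < ‖φ‖ by linarith [pow_pos hδ 2])
    have hne : {T : A0Space p | ‖T‖ < 1 ∧ ‖φ‖ - δ ^ 2 < φ T}.Nonempty := by
      rcases le_total 0 (φ T) with h | h
      · exact ⟨T, hT, by rwa [Real.norm_of_nonneg h] at hT'⟩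
      · exact ⟨-T, by rwa [norm_neg], by rwa [map_neg, ← Real.norm_of_nonpos h]⟩
    obtain ⟨T, h1, h2⟩ := dense_inclusion_mem_A00.exists_mem_open hopen hne
    exact ⟨T, h1, h2.1, h2.2⟩
  obtain ⟨S, hS⟩ := (eventually_compress_eq hp hT0).exists
  refine ⟨S, ContinuousLinearMap.opNorm_le_of_unit_norm hε.le fun g hg => ?_⟩
  have key (g : A0Space p) (hg : ‖g‖ = 1) : φ (g - compressA0 hp S g) ≤ ε := by
    have h1 : ‖T + δ • (g - compressA0 hp S g)‖ ≤ 1 + 2 * δ ^ 2 := by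
      rw [← norm_inclusion]
      simp only [map_add, map_smul, map_sub, inclusion_compressA0]
      exact norm_add_smul_sub_compress_le (by rw [norm_inclusion]; exact hT1.le) hS
        (isForm_inclusion hp g) (by rw [norm_inclusion, hg]) hδ.le hδ2
    have h2 : φ (T + δ • (g - compressA0 hp S g)) ≤ ‖φ‖ * (1 + 2 * δ ^ 2) :=
      (le_abs_self _).trans (φ.le_of_opNorm_le_of_le le_rfl h1)
    rw [map_add, map_smul, smul_eq_mul] at h2
    have h3 : δ * φ (g - compressA0 hp S g) ≤ δ * (δ * (1 + 2 * ‖φ‖)) := by nlinarith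
    exact (le_of_mul_le_mul_left h3 hδ).trans hδε
  have hval (g : A0Space p) : (φ - φ.comp (compressA0 hp S)) g = φ (g - compressA0 hp S g) := by
    rw [map_sub]; rfl
  rw [Real.norm_eq_abs, abs_le]
  constructor
  · have := key (-g) (by rwa [norm_neg])
    rw [← hval, map_neg] at this
    linarith
  · rw [hval]
    exact key g hg

/-- An element of the double dual that vanishes at the evaluations at points vanishes at compressed
functionals, since these are linear combinations of evaluations. -/
lemma bidual_comp_compressA0_eq_zero (hp : ∀ ρ σ, p ρ σ = projProb H (e ρ) (e σ))
    {F : Bidual p} (hF : ∀ ρ, F (evalAt p ρ) = 0) (φ : StrongDual ℝ (A0Space p))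
    (S : Finset (Σ α, H α)) : F (φ.comp (compressA0 hp S)) = 0 := by
  classical
  let ev : ProjUnion H → StrongDual ℝ (A0Space p) := fun ρ => evalAt p (e.symm ρ)
  have hFev (α : ι) (x y : H α) : F (polar ev α x y) = 0 := by
    refine (polar_map F.toLinearMap ev α x y).symm.trans ?_
    have : (fun ρ => F.toLinearMap (ev ρ)) = fun _ => 0 := funext fun ρ => hF _
    rw [this]
    simp [polar, homog]
  have hev (g : A0Space p) (α : ι) (x y : H α) :
      polar ev α x y g = polar (pull e (inclusion p g)) α x y :=
    (polar_map (ContinuousLinearMap.apply ℝ ℝ g).toLinearMap ev α x y).symm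
  let L : (Σ α : {α // α ∈ S.image Sigma.fst}, fiber S α.1 × fiber S α.1 × Bool) →
      StrongDual ℝ (A0Space p) := fun k =>
    polar ev k.1.1 k.2.1.1 (if k.2.2.2 then Complex.I • k.2.2.1.1 else k.2.2.1.1)
  have hspan : (φ.comp (compressA0 hp S)).toLinearMap ∈
      Submodule.span ℝ (Set.range fun k => (L k).toLinearMap) := by
    refine mem_span_of_iInf_ker_le_ker fun g hg => ?_
    simp only [Submodule.mem_iInf, LinearMap.mem_ker] at hg
    have hform := isForm_inclusion hp g
    choose T hTsa hTn hT using
      hform.exists_operator (norm_nonneg _) (abs_pull_le e (inclusion p g))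
    have hst (α : ι) (s t : H α) (hs : s ∈ fiber S α) (ht : t ∈ fiber S α) :
        ⟪s, T α t⟫_ℂ = 0 := by
      have hα : α ∈ S.image Sigma.fst := Finset.mem_image_of_mem Sigma.fst (mem_fiber.1 hs)
      have h1 : polar ev α s t g = 0 := hg ⟨⟨α, hα⟩, ⟨s, hs⟩, ⟨t, ht⟩, false⟩
      have h2 : polar ev α s (Complex.I • t) g = 0 := hg ⟨⟨α, hα⟩, ⟨s, hs⟩, ⟨t, ht⟩, true⟩
      rw [hev, ← hT] at h1 h2
      rw [map_smul, inner_smul_right] at h2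
      apply Complex.ext
      · exact h1
      · simpa using h2
    have hspanAt (α : ι) (x y : H α) (hx : x ∈ spanAt S α) (hy : y ∈ spanAt S α) :
        ⟪x, T α y⟫_ℂ = 0 := by
      induction hx, hy using Submodule.span_induction₂ with
      | mem_mem x y hx hy => exact hst α x y hx hy
      | zero_left y hy => simp
      | zero_right x hx => simp
      | add_left x y z _ _ _ h1 h2 => rw [inner_add_left, h1, h2, add_zero]
      | add_right x y z _ _ _ h1 h2 => rw [map_add, inner_add_right, h1, h2, add_zero]
      | smul_left r x y _ _ h => rw [inner_smul_left, h, mul_zero]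
      | smul_right r x y _ _ h => rw [map_smul, inner_smul_right, h, mul_zero]
    have hzero : compressA0 hp S g = 0 := by
      refine inclusion_injective ?_
      rw [inclusion_compressA0, map_zero]
      ext ρ
      rw [compress_apply, ← polar_self, ← hT, hspanAt _ _ _
        (Submodule.starProjection_apply_mem _ _) (Submodule.starProjection_apply_mem _ _)]
      simp
    change φ (compressA0 hp S g) = 0
    rw [hzero, map_zero]
  obtain ⟨c, hc⟩ := (Submodule.mem_span_range_iff_exists_fun ℝ).1 hspan
  have hsum : φ.comp (compressA0 hp S) = ∑ k, c k • L k := by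
    ext g
    have := LinearMap.congr_fun hc g
    simpa using this.symm
  rw [hsum, map_sum]
  exact Finset.sum_eq_zero fun k _ => by rw [map_smul, hFev, smul_zero]

/-- The evaluations at points span a norm-dense subspace of the dual of `𝔄₀(P)`: an element of the
double dual is determined by its function on `P`. -/
lemma bidualFn_injective (hp : ∀ ρ σ, p ρ σ = projProb H (e ρ) (e σ)) :
    Function.Injective (bidualFn p) := by
  refine (injective_iff_map_eq_zero _).2 fun F hF => ?_
  have hF' (ρ : P) : F (evalAt p ρ) = 0 := congrArg (fun f : EllInfty P => f ρ) hF
  ext φ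
  refine norm_le_zero_iff.1 (le_of_forall_pos_le_add fun ε hε => ?_)
  obtain ⟨S, hS⟩ := exists_norm_sub_comp_compressA0_le hp φ
    (show 0 < ε / (‖F‖ + 1) by positivity)
  have h1 : F φ = F (φ - φ.comp (compressA0 hp S)) := by
    rw [map_sub, bidual_comp_compressA0_eq_zero hp hF', sub_zero]
  rw [h1, zero_add]
  refine (F.le_of_opNorm_le_of_le le_rfl hS).trans ?_
  rw [mul_div_assoc', div_le_iff₀ (by positivity)]
  nlinarith [norm_nonneg F]

lemma range_bidualFn_eq_formSubmodule (hp : ∀ ρ σ, p ρ σ = projProb H (e ρ) (e σ)) :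
    Set.range (bidualFn p) = {f | IsForm (pull e f)} := by
  ext f
  constructor
  · rintro ⟨F, rfl⟩
    exact isForm_bidualFn hp F
  · intro hf
    obtain ⟨F, -, hF⟩ := exists_bidualFn_eq hp hf
    exact ⟨F, hF⟩

lemma isometry_bidualFn (hp : ∀ ρ σ, p ρ σ = projProb H (e ρ) (e σ)) :
    Isometry (bidualFn p) := by
  refine AddMonoidHomClass.isometry_of_norm (bidualFn p) fun F => le_antisymm ?_ ?_
  · refine lp.norm_le_of_forall_le (norm_nonneg _) fun ρ => ?_
    exact (F.le_of_opNorm_le_of_le le_rfl (norm_evalAt_le p ρ)).trans (mul_one _).le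
  · obtain ⟨F', hn, hF'⟩ := exists_bidualFn_eq hp (isForm_bidualFn hp F)
    rwa [bidualFn_injective hp hF'] at hn

end Bidual

/-! ### Direct sums of operator algebras -/

section DirectSum

variable {ι : Type*} (H : ι → Type*) [∀ α, NormedAddCommGroup (H α)]
  [∀ α, InnerProductSpace ℂ (H α)] [∀ α, CompleteSpace (H α)]

variable {H} in
lemma isSymmetric_apply (A : selfAdjoint (DirectSumB H)) (α : ι) :
    ((A : DirectSumB H) α : H α →ₗ[ℂ] H α).IsSymmetric := by
  rw [← ContinuousLinearMap.isSelfAdjoint_iff_isSymmetric]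
  have h : star (A : DirectSumB H) = A := A.2
  exact congrArg (fun B : DirectSumB H => B α) h

/-- The forms on `⋃_α ℙℋ_α` are the functions of self-adjoint elements of `⊕_α 𝔅(ℋ_α)`. -/
lemma range_hatFn : Set.range (hatFn H) = {f | IsForm (fun ρ => f ρ)} := by
  ext f
  constructor
  · rintro ⟨A, rfl⟩
    exact isForm_rayState (fun α => (A : DirectSumB H) α) (isSymmetric_apply A)
  · intro hf
    have hfb (ρ : ProjUnion H) : |f ρ| ≤ ‖f‖ := lp.norm_apply_le_norm ENNReal.top_ne_zero f ρ
    choose T hTsa hTn hT using IsForm.exists_operator hf (norm_nonneg f) hfb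
    let A : DirectSumB H := ⟨T, memℓp_infty ⟨‖f‖, by rintro _ ⟨α, rfl⟩; exact hTn α⟩⟩
    have hA : IsSelfAdjoint A := lp.ext (funext fun α => hTsa α)
    refine ⟨⟨A, hA⟩, lp.ext (funext fun ρ => ?_)⟩
    have h0 : ‖ρ.2.rep‖ ≠ 0 := norm_ne_zero_iff.2 ρ.2.rep_nonzero
    change (⟪ρ.2.rep, T ρ.1 ρ.2.rep⟫_ℂ).re / ‖ρ.2.rep‖ ^ 2 = f ρ
    rw [hT, polar_self, homog_rep, smul_eq_mul]
    field_simp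

variable {H} in
/-- The norm of a self-adjoint element of `⊕_α 𝔅(ℋ_α)` is bounded by its numerical radius. -/
lemma norm_apply_le_norm_hatFn (A : selfAdjoint (DirectSumB H)) (α : ι) :
    ‖(A : DirectSumB H) α‖ ≤ ‖hatFn H A‖ := by
  have hsym := isSymmetric_apply A
  have hform := isForm_rayState (fun α => (A : DirectSumB H) α) hsym
  refine ContinuousLinearMap.opNorm_le_of_re_inner_le (norm_nonneg _) fun x y hx hy => ?_
  have h := hform.abs_polar_le (M := ‖hatFn H A‖)
    (fun ρ => lp.norm_apply_le_norm ENNReal.top_ne_zero (hatFn H A) ρ) α x y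
  rw [polar_rayState _ hsym, hx, hy, mul_one, mul_one] at h
  exact (congrArg Complex.re (hsym α x y)).le.trans ((le_abs_self _).trans h)

lemma isometry_hatFn : Isometry (hatFn H) := by
  refine Isometry.of_dist_eq fun A B => ?_
  have hsub : hatFn H A - hatFn H B = hatFn H (A - B) := by
    refine lp.ext (funext fun ρ => ?_)
    change rayState ρ.2 ((A : DirectSumB H) ρ.1) - rayState ρ.2 ((B : DirectSumB H) ρ.1) =
      rayState ρ.2 ((A : DirectSumB H) ρ.1 - (B : DirectSumB H) ρ.1)
    simp [rayState, sub_div]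
  rw [dist_eq_norm, dist_eq_norm, hsub]
  refine le_antisymm ?_ ?_
  · exact lp.norm_le_of_forall_le (norm_nonneg _) fun ρ => (abs_rayState_le _ _).trans
      (lp.norm_apply_le_norm ENNReal.top_ne_zero ((A - B : selfAdjoint (DirectSumB H)) :
        DirectSumB H) ρ.1)
  · exact lp.norm_le_of_forall_le (norm_nonneg _) fun α => norm_apply_le_norm_hatFn (A - B) α

end DirectSum

/-! ### Irreducible representations -/

section Representations

variable {A : Type*} [CStarAlgebra A]
  {K : Type*} [NormedAddCommGroup K] [InnerProductSpace ℂ K] [CompleteSpace K]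
  {K' : Type*} [NormedAddCommGroup K'] [InnerProductSpace ℂ K'] [CompleteSpace K']

/-- A representation with trivial commutant: every bounded operator that commutes with the
representation is a multiple of the identity. The zero space is allowed. -/
def HasTrivialCommutant (π : A →⋆ₐ[ℂ] (K →L[ℂ] K)) : Prop :=
  ∀ T : K →L[ℂ] K, (∀ a x, T (π a x) = π a (T x)) → ∃ c : ℂ, ∀ x, T x = c • x

omit [CompleteSpace K] in
lemma inner_self_eq_ofReal (x : K) : ⟪x, x⟫_ℂ = ((‖x‖ ^ 2 : ℝ) : ℂ) := by
  rw [inner_self_eq_norm_sq_to_K]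
  push_cast
  rfl

lemma inner_rep_left (π : A →⋆ₐ[ℂ] (K →L[ℂ] K)) (a : A) (x y : K) :
    ⟪π a x, y⟫_ℂ = ⟪x, π (star a) y⟫_ℂ := by
  rw [map_star, ContinuousLinearMap.star_eq_adjoint, ContinuousLinearMap.adjoint_inner_right]

lemma inner_rep_rep (π : A →⋆ₐ[ℂ] (K →L[ℂ] K)) (a b : A) (x : K) :
    ⟪π a x, π b x⟫_ℂ = ⟪x, π (star a * b) x⟫_ℂ := by
  rw [inner_rep_left, map_mul, mul_apply_eq_comp]

omit [CompleteSpace K] in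
/-- The orthogonal projection onto a subspace that reduces an operator commutes with it. -/
lemma starProjection_apply_comm (N : Submodule ℂ K) [N.HasOrthogonalProjection] (S T : K →L[ℂ] K)
    (hadj : ∀ x y, ⟪T x, y⟫_ℂ = ⟪x, S y⟫_ℂ) (hS : ∀ x ∈ N, S x ∈ N) (hT : ∀ x ∈ N, T x ∈ N)
    (x : K) : N.starProjection (T x) = T (N.starProjection x) := by
  refine Submodule.eq_starProjection_of_mem_orthogonal (hT _ (N.starProjection_apply_mem x)) ?_
  rw [← map_sub, Submodule.mem_orthogonal']
  intro y hy
  rw [hadj]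
  exact Submodule.inner_left_of_mem_orthogonal (hS y hy)
    (Submodule.sub_starProjection_mem_orthogonal x)

/-- The adjoint of an intertwiner is an intertwiner. -/
lemma adjoint_intertwines {π : A →⋆ₐ[ℂ] (K →L[ℂ] K)} {π' : A →⋆ₐ[ℂ] (K' →L[ℂ] K')}
    {V : K →L[ℂ] K'} (hV : ∀ a x, V (π a x) = π' a (V x)) (a : A) (y : K') :
    V.adjoint (π' a y) = π a (V.adjoint y) := by
  refine ext_inner_right ℂ fun x => ?_
  rw [ContinuousLinearMap.adjoint_inner_left, inner_rep_left, ← hV, inner_rep_left,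
    ContinuousLinearMap.adjoint_inner_left]

/-- **Schur's lemma**: a nonzero intertwiner between irreducible representations is proportional to
a unitary equivalence. -/
lemma exists_unitary_of_intertwiner {π : A →⋆ₐ[ℂ] (K →L[ℂ] K)} {π' : A →⋆ₐ[ℂ] (K' →L[ℂ] K')}
    (hπ : HasTrivialCommutant π) (hπ' : HasTrivialCommutant π') {V : K →L[ℂ] K'}
    (hV : ∀ a x, V (π a x) = π' a (V x)) {x₀ : K} (hx₀ : V x₀ ≠ 0) :
    ∃ U : K ≃ₗᵢ[ℂ] K', ∀ a x, U (π a x) = π' a (U x) := by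
  have hVadj := adjoint_intertwines hV
  obtain ⟨c, hc⟩ := hπ (V.adjoint ∘L V) fun a x => by
    simp only [ContinuousLinearMap.comp_apply, hV, hVadj]
  obtain ⟨c', hc'⟩ := hπ' (V ∘L V.adjoint) fun a x => by
    simp only [ContinuousLinearMap.comp_apply, hV, hVadj]
  simp only [ContinuousLinearMap.comp_apply] at hc hc'
  have hnorm (x : K) : ((‖V x‖ ^ 2 : ℝ) : ℂ) = c * ((‖x‖ ^ 2 : ℝ) : ℂ) := by
    have h1 : ⟪x, V.adjoint (V x)⟫_ℂ = c * ⟪x, x⟫_ℂ := by rw [hc, inner_smul_right]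
    rw [ContinuousLinearMap.adjoint_inner_right, inner_self_eq_norm_sq_to_K,
      inner_self_eq_norm_sq_to_K] at h1
    push_cast
    exact h1
  have hx0 : ‖x₀‖ ≠ 0 := fun h => hx₀ (by rw [norm_eq_zero.1 h, map_zero])
  have hV0 : ‖V x₀‖ ≠ 0 := norm_ne_zero_iff.2 hx₀
  obtain ⟨r, hr, rfl⟩ : ∃ r : ℝ, 0 < r ∧ c = ((r ^ 2 : ℝ) : ℂ) := by
    refine ⟨‖V x₀‖ / ‖x₀‖, by positivity, ?_⟩
    have h := hnorm x₀
    rw [div_pow, Complex.ofReal_div, h, mul_div_assoc, div_self, mul_one]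
    exact_mod_cast pow_ne_zero 2 hx0
  have hnorm' (x : K) : ‖V x‖ = r * ‖x‖ := by
    have h := hnorm x
    rw [← Complex.ofReal_mul, Complex.ofReal_inj, ← mul_pow] at h
    exact (pow_left_inj₀ (norm_nonneg _) (by positivity) two_ne_zero).1 h
  -- the two multiples of the identity agree, so that `V` is onto
  have hcc' : c' = ((r ^ 2 : ℝ) : ℂ) := by
    have h1 : V (V.adjoint (V x₀)) = ((r ^ 2 : ℝ) : ℂ) • V x₀ := by rw [hc, map_smul]
    rw [hc'] at h1
    exact smul_left_injective ℂ hx₀ h1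
  have hr0 : (r : ℂ) ≠ 0 := by exact_mod_cast hr.ne'
  let W : K →ₗᵢ[ℂ] K' :=
    { toLinearMap := ((r : ℂ)⁻¹ • V : K →L[ℂ] K').toLinearMap
      norm_map' := fun x => by
        change ‖(r : ℂ)⁻¹ • V x‖ = ‖x‖
        rw [norm_smul, hnorm', norm_inv, Complex.norm_real, Real.norm_of_nonneg hr.le,
          inv_mul_cancel_left₀ hr.ne'] }
  have hW (x : K) : W x = (r : ℂ)⁻¹ • V x := rfl
  have hsurj : Function.Surjective W := fun y => by
    refine ⟨(r : ℂ)⁻¹ • V.adjoint y, ?_⟩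
    rw [hW, map_smul, hc', hcc', smul_smul, smul_smul, Complex.ofReal_pow]
    field_simp
    simp
  refine ⟨LinearIsometryEquiv.ofSurjective W hsurj, fun a x => ?_⟩
  simp only [LinearIsometryEquiv.coe_ofSurjective, hW, hV, map_smul]

/-- Vectors that are dominated by a cyclic vector are images of it under an intertwiner. -/
lemma exists_intertwiner_of_norm_le {π : A →⋆ₐ[ℂ] (K →L[ℂ] K)} {π' : A →⋆ₐ[ℂ] (K' →L[ℂ] K')}
    {η : K} {η' : K'} (hη : DenseRange fun a => π a η) {C : ℝ}
    (hC : ∀ a, ‖π' a η'‖ ≤ C * ‖π a η‖) :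
    ∃ V : K →L[ℂ] K', V η = η' ∧ ∀ a x, V (π a x) = π' a (V x) := by
  let orb : A →ₗ[ℂ] K :=
    { toFun := fun a => π a η
      map_add' := fun a b => by rw [map_add]; rfl
      map_smul' := fun c a => by rw [map_smul]; rfl }
  let orb' : A →ₗ[ℂ] K' :=
    { toFun := fun a => π' a η'
      map_add' := fun a b => by rw [map_add]; rfl
      map_smul' := fun c a => by rw [map_smul]; rfl }
  have hV (a : A) : orb'.extendOfNorm orb (π a η) = π' a η' :=
    LinearMap.extendOfNorm_eq (f := orb') (e := orb) hη ⟨C, hC⟩ a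
  refine ⟨orb'.extendOfNorm orb, by simpa using hV 1, fun a x => ?_⟩
  refine congrFun (DenseRange.equalizer (g := fun x => orb'.extendOfNorm orb (π a x))
    (h := fun x => π' a (orb'.extendOfNorm orb x)) hη (by fun_prop) (by fun_prop)
    (funext fun b => ?_)) x
  change orb'.extendOfNorm orb (π a (π b η)) = π' a (orb'.extendOfNorm orb (π b η))
  rw [hV, ← mul_apply_eq_comp, ← map_mul, hV, map_mul, mul_apply_eq_comp]

/-- The closed subspace generated from a vector by a representation. -/
def orbitClosure (π : A →⋆ₐ[ℂ] (K →L[ℂ] K)) (η : K) : Submodule ℂ K :=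
  (LinearMap.range ({ toFun := fun a => π a η
                      map_add' := fun a b => by rw [map_add]; rfl
                      map_smul' := fun c a => by rw [map_smul]; rfl } :
    A →ₗ[ℂ] K)).topologicalClosure

lemma coe_orbitClosure (π : A →⋆ₐ[ℂ] (K →L[ℂ] K)) (η : K) :
    (orbitClosure π η : Set K) = closure (Set.range fun a => π a η) := rfl

instance (π : A →⋆ₐ[ℂ] (K →L[ℂ] K)) (η : K) : CompleteSpace (orbitClosure π η) :=
  (Submodule.isClosed_topologicalClosure _).completeSpace_coe

lemma mem_orbitClosure_self (π : A →⋆ₐ[ℂ] (K →L[ℂ] K)) (η : K) : η ∈ orbitClosure π η :=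
  subset_closure ⟨1, by simp⟩

lemma rep_mem_orbitClosure (π : A →⋆ₐ[ℂ] (K →L[ℂ] K)) (η : K) (a : A) {x : K}
    (hx : x ∈ orbitClosure π η) : π a x ∈ orbitClosure π η := by
  refine map_mem_closure (π a).continuous hx ?_
  rintro _ ⟨b, rfl⟩
  exact ⟨a * b, by simp⟩

lemma starProjection_orbitClosure_comm (π : A →⋆ₐ[ℂ] (K →L[ℂ] K)) (η : K) (a : A) (x : K) :
    (orbitClosure π η).starProjection (π a x) = π a ((orbitClosure π η).starProjection x) :=
  starProjection_apply_comm _ (π (star a)) (π a) (inner_rep_left π a)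
    (fun _ => rep_mem_orbitClosure π η _) (fun _ => rep_mem_orbitClosure π η _) x

/-- In an irreducible representation every nonzero vector is cyclic. -/
lemma HasTrivialCommutant.denseRange {π : A →⋆ₐ[ℂ] (K →L[ℂ] K)} (hπ : HasTrivialCommutant π)
    {η : K} (hη : η ≠ 0) : DenseRange fun a => π a η := by
  obtain ⟨c, hc⟩ := hπ _ (starProjection_orbitClosure_comm π η)
  have h1 := hc η
  rw [Submodule.starProjection_eq_self_iff.2 (mem_orbitClosure_self π η)] at h1
  have hc1 : c = 1 := smul_left_injective ℂ hη (by simpa using h1.symm)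
  intro x
  rw [← coe_orbitClosure]
  refine Submodule.starProjection_eq_self_iff.1 ?_
  rw [hc, hc1, one_smul]

/-- Unit vectors that implement the same state in an irreducible representation are
proportional. -/
lemma HasTrivialCommutant.exists_smul_eq {π : A →⋆ₐ[ℂ] (K →L[ℂ] K)} (hπ : HasTrivialCommutant π)
    {x y : K} (hx : x ≠ 0) (h : ∀ a, ⟪x, π a x⟫_ℂ = ⟪y, π a y⟫_ℂ) : ∃ c : ℂ, c • x = y := by
  obtain ⟨V, hVx, hV⟩ := exists_intertwiner_of_norm_le (π' := π) (η' := y) (C := 1)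
    (hπ.denseRange hx) fun a => by
      refine le_of_eq ?_
      rw [one_mul, ← pow_left_inj₀ (norm_nonneg _) (norm_nonneg _) two_ne_zero,
        ← inner_self_eq_norm_sq (𝕜 := ℂ), ← inner_self_eq_norm_sq (𝕜 := ℂ), inner_rep_rep,
        inner_rep_rep, h]
  obtain ⟨c, hc⟩ := hπ V hV
  exact ⟨c, by rw [← hc, hVx]⟩

variable (π : A →⋆ₐ[ℂ] (K →L[ℂ] K)) (η : K)

/-- The functional `a ↦ (η, T π(a) η)`. -/
def vectorFunctional (T : K →L[ℂ] K) : StrongDual ℂ A :=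
  LinearMap.mkContinuous
    { toFun := fun a => ⟪η, T (π a η)⟫_ℂ
      map_add' := fun a b => by simp
      map_smul' := fun c a => by simp }
    (‖η‖ * (‖T‖ * ‖η‖)) fun a => by
      refine (norm_inner_le_norm _ _).trans ?_
      have h1 : ‖π a η‖ ≤ ‖a‖ * ‖η‖ := (π a).le_of_opNorm_le (NonUnitalStarAlgHom.norm_apply_le π a) η
      calc ‖η‖ * ‖T (π a η)‖ ≤ ‖η‖ * (‖T‖ * (‖a‖ * ‖η‖)) := by
            gcongr
            exact T.le_of_opNorm_le_of_le le_rfl h1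
        _ = ‖η‖ * (‖T‖ * ‖η‖) * ‖a‖ := by ring

lemma vectorFunctional_apply (T : K →L[ℂ] K) (a : A) :
    vectorFunctional π η T a = ⟪η, T (π a η)⟫_ℂ := rfl

variable {π} {η}

lemma vectorFunctional_star_mul {T : K →L[ℂ] K} (hT : ∀ a x, T (π a x) = π a (T x)) (b : A) :
    vectorFunctional π η T (star b * b) = ⟪π b η, T (π b η)⟫_ℂ := by
  rw [vectorFunctional_apply, hT, map_mul, mul_apply_eq_comp, ← inner_rep_left, hT]

variable [PartialOrder A] [StarOrderedRing A]

lemma vectorFunctional_nonneg {T : K →L[ℂ] K} (hT : ∀ a x, T (π a x) = π a (T x))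
    (hpos : ∀ x, 0 ≤ ⟪x, T x⟫_ℂ) (a : A) (ha : 0 ≤ a) : 0 ≤ vectorFunctional π η T a := by
  obtain ⟨b, rfl⟩ := CStarAlgebra.nonneg_iff_eq_star_mul_self.1 ha
  rw [vectorFunctional_star_mul hT]
  exact hpos _

end Representations

/-- The perturbation `1 + T` of the identity by a self-adjoint contraction is positive. -/
lemma inner_one_add_apply_nonneg {K : Type*} [NormedAddCommGroup K] [InnerProductSpace ℂ K]
    {T : K →L[ℂ] K} (hT : (T : K →ₗ[ℂ] K).IsSymmetric) (hT1 : ‖T‖ ≤ 1) (x : K) :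
    0 ≤ ⟪x, (1 + T) x⟫_ℂ := by
  have h1 : ⟪x, (1 + T) x⟫_ℂ = ((‖x‖ ^ 2 : ℝ) : ℂ) + ⟪x, T x⟫_ℂ := by
    rw [add_apply, inner_add_right, one_apply_eq_self, inner_self_eq_norm_sq_to_K]
    push_cast
    rfl
  have h2 : |(⟪x, T x⟫_ℂ).re| ≤ ‖x‖ ^ 2 :=
    calc |(⟪x, T x⟫_ℂ).re| ≤ ‖⟪x, T x⟫_ℂ‖ := Complex.abs_re_le_norm _
      _ ≤ ‖x‖ * ‖T x‖ := norm_inner_le_norm _ _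
      _ ≤ ‖x‖ * (1 * ‖x‖) := by gcongr; exact T.le_of_opNorm_le hT1 x
      _ = ‖x‖ ^ 2 := by ring
  have h3 : (⟪x, T x⟫_ℂ).im = 0 := by
    have h4 : (starRingEnd ℂ) ⟪x, T x⟫_ℂ = ⟪x, T x⟫_ℂ := by
      rw [inner_conj_symm]
      exact hT x x
    exact Complex.conj_eq_iff_im.1 h4
  rw [h1, Complex.nonneg_iff]
  constructor
  · rw [Complex.add_re, Complex.ofReal_re]
    linarith [neg_abs_le (⟪x, T x⟫_ℂ).re]
  · rw [Complex.add_im, Complex.ofReal_im, h3, add_zero]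

/-! ### Pure states -/

section PureStates

variable {A : Type*} [CStarAlgebra A] [PartialOrder A] [StarOrderedRing A]

lemma gns_dense (f : A →ₚ[ℂ] ℂ) :
    DenseRange fun a => f.gnsStarAlgHom a ((f.toPreGNS 1 : f.PreGNS) : f.GNS) := by
  have h (a : A) : f.gnsStarAlgHom a ((f.toPreGNS 1 : f.PreGNS) : f.GNS) =
      ((f.toPreGNS a : f.PreGNS) : f.GNS) := by simp
  simp only [h]
  exact UniformSpace.Completion.denseRange_coe.comp f.toPreGNS.surjective.denseRange
    (UniformSpace.Completion.continuous_coe _)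

lemma gns_inner (f : A →ₚ[ℂ] ℂ) (a : A) :
    ⟪((f.toPreGNS 1 : f.PreGNS) : f.GNS),
      f.gnsStarAlgHom a ((f.toPreGNS 1 : f.PreGNS) : f.GNS)⟫_ℂ = f a := by
  simp [PositiveLinearMap.preGNS_inner_def]

lemma PureState.denseRange (ρ : PureState A) : DenseRange fun a => ρ.rep a ρ.cyclic :=
  gns_dense ρ.toPos

lemma PureState.cyclic_ne_zero (ρ : PureState A) : ρ.cyclic ≠ 0 :=
  norm_ne_zero_iff.1 (by rw [ρ.norm_cyclic]; exact one_ne_zero)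

/-- If a self-adjoint contraction in the commutant of the GNS representation of a pure state `ρ` has
expectation value zero in the cyclic vector, then it exhibits `ρ` as the midpoint of two states, and
hence vanishes. -/
lemma PureState.eq_zero_of_isSymmetric (ρ : PureState A) {T : ρ.Space →L[ℂ] ρ.Space}
    (hT : ∀ a x, T (ρ.rep a x) = ρ.rep a (T x)) (hsym : (T : ρ.Space →ₗ[ℂ] ρ.Space).IsSymmetric)
    (hT1 : ‖T‖ ≤ 1) (h0 : ⟪ρ.cyclic, T ρ.cyclic⟫_ℂ = 0) : T = 0 := by
  have hstate (S : ρ.Space →L[ℂ] ρ.Space) (hS : ∀ a x, S (ρ.rep a x) = ρ.rep a (S x))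
      (hsymS : (S : ρ.Space →ₗ[ℂ] ρ.Space).IsSymmetric) (hS1 : ‖S‖ ≤ 1)
      (hS0 : ⟪ρ.cyclic, S ρ.cyclic⟫_ℂ = 0) :
      vectorFunctional ρ.rep ρ.cyclic (1 + S) ∈ stateSpace A := by
    refine ⟨fun a ha => vectorFunctional_nonneg (fun a x => ?_)
      (inner_one_add_apply_nonneg hsymS hS1) a ha, ?_⟩
    · simp only [add_apply, one_apply_eq_self, hS, map_add]
    · rw [vectorFunctional_apply, map_one]
      simp only [add_apply, one_apply_eq_self, inner_add_right, hS0, add_zero]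
      rw [inner_self_eq_norm_sq_to_K, ρ.norm_cyclic]
      simp
  have hval (S : ρ.Space →L[ℂ] ρ.Space) (a : A) :
      vectorFunctional ρ.rep ρ.cyclic (1 + S) a =
        ρ.1 a + ⟪ρ.cyclic, S (ρ.rep a ρ.cyclic)⟫_ℂ := by
    rw [vectorFunctional_apply, add_apply, inner_add_right, one_apply_eq_self,
      ρ.inner_cyclic]
  have hplus := hstate T hT hsym hT1 h0
  have hminus := hstate (-T) (fun a x => by rw [neg_apply, neg_apply, hT, map_neg])
    (fun x y => by simpa using hsym x y) (by rwa [norm_neg]) (by simp [h0])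
  have hseg : ρ.1 ∈ openSegment ℝ (vectorFunctional ρ.rep ρ.cyclic (1 + T))
      (vectorFunctional ρ.rep ρ.cyclic (1 + -T)) := by
    refine ⟨1 / 2, 1 / 2, by norm_num, by norm_num, by norm_num, ?_⟩
    ext a
    rw [add_apply, smul_apply, smul_apply, hval, hval, Complex.real_smul, Complex.real_smul,
      neg_apply, inner_neg_right]
    push_cast
    ring
  have heq := (mem_extremePoints.1 ρ.2).2 _ hplus _ hminus hseg |>.1
  have hT0 : T ρ.cyclic = 0 := by
    refine ρ.denseRange.eq_zero_of_inner_left (𝕜 := ℂ) fun a => ?_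
    have h1 := hval T a
    rw [heq] at h1
    exact (hsym _ _).trans (left_eq_add.1 h1)
  refine ContinuousLinearMap.coeFn_injective (ρ.denseRange.equalizer T.continuous
    continuous_const (funext fun a => ?_))
  change T (ρ.rep a ρ.cyclic) = 0
  rw [hT, hT0, map_zero]

/-- The GNS representation of a pure state is irreducible. -/
lemma PureState.hasTrivialCommutant (ρ : PureState A) : HasTrivialCommutant ρ.rep := by
  have hsa (T : ρ.Space →L[ℂ] ρ.Space) (hT : ∀ a x, T (ρ.rep a x) = ρ.rep a (T x))
      (hadj : IsSelfAdjoint T) : ∃ c : ℂ, ∀ x, T x = c • x := by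
    have hsym := ContinuousLinearMap.isSelfAdjoint_iff_isSymmetric.1 hadj
    let τ : ℝ := (⟪ρ.cyclic, T ρ.cyclic⟫_ℂ).re
    have hτ : ⟪ρ.cyclic, T ρ.cyclic⟫_ℂ = τ := by
      refine (Complex.conj_eq_iff_re.1 ?_).symm
      rw [inner_conj_symm]
      exact hsym _ _
    let T' : ρ.Space →L[ℂ] ρ.Space := T - (τ : ℂ) • 1
    let s : ℝ := (‖T'‖ + 1)⁻¹
    have hs : 0 < s := by positivity
    have hT' (x : ρ.Space) : T' x = T x - (τ : ℂ) • x := rfl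
    have hzero := ρ.eq_zero_of_isSymmetric (T := (s : ℂ) • T') (fun a x => by
        simp only [smul_apply, hT', hT, map_sub, map_smul])
      (fun x y => by
        change ⟪(s : ℂ) • T' x, y⟫_ℂ = ⟪x, (s : ℂ) • T' y⟫_ℂ
        have h1 : ⟪T x, y⟫_ℂ = ⟪x, T y⟫_ℂ := hsym x y
        rw [hT', hT', inner_smul_left, inner_smul_right, inner_sub_left, inner_sub_right,
          inner_smul_left, inner_smul_right, Complex.conj_ofReal, Complex.conj_ofReal, h1])
      (by
        rw [norm_smul, Complex.norm_real, Real.norm_of_nonneg hs.le, inv_mul_le_iff₀ (by positivity)]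
        linarith)
      (by
        rw [smul_apply, hT', inner_smul_right, inner_sub_right, inner_smul_right, hτ,
          inner_self_eq_norm_sq_to_K, ρ.norm_cyclic]
        simp)
    have hs0 : (s : ℂ) ≠ 0 := by exact_mod_cast hs.ne'
    have hT'0 : T' = 0 := (smul_eq_zero.1 hzero).resolve_left hs0
    refine ⟨τ, fun x => ?_⟩
    rw [← sub_eq_zero, ← hT', hT'0, zero_apply]
  intro T hT
  have hTadj := adjoint_intertwines hT
  obtain ⟨c, hc⟩ := hsa (T + T.adjoint) (fun a x => by
      simp only [add_apply, hT, hTadj, map_add])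
    (IsSelfAdjoint.add_star_self T)
  obtain ⟨d, hd⟩ := hsa (Complex.I • (T - T.adjoint)) (fun a x => by
      simp only [smul_apply, sub_apply, hT, hTadj, map_sub, map_smul]) (by
    rw [IsSelfAdjoint, star_smul, star_sub, ContinuousLinearMap.star_eq_adjoint,
      ContinuousLinearMap.star_eq_adjoint, ContinuousLinearMap.adjoint_adjoint, Complex.star_def,
      Complex.conj_I, neg_smul, ← smul_neg, neg_sub])
  refine ⟨(1 / 2 : ℂ) * (c - Complex.I * d), fun x => ?_⟩
  rw [mul_smul, sub_smul, mul_smul, ← hc, ← hd]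
  simp only [add_apply, smul_apply, sub_apply]
  rw [smul_smul, Complex.I_mul_I, neg_one_smul, sub_neg_eq_add, add_add_sub_cancel, ← two_smul ℂ,
    smul_smul]
  norm_num

section VectorStates

variable {K : Type*} [NormedAddCommGroup K] [InnerProductSpace ℂ K] [CompleteSpace K]
  {π : A →⋆ₐ[ℂ] (K →L[ℂ] K)}

lemma vectorFunctional_one_mem_stateSpace {η : K} (hη : ‖η‖ = 1) :
    vectorFunctional π η 1 ∈ stateSpace A := by
  refine ⟨fun a ha => vectorFunctional_nonneg (fun a x => rfl) (fun x => ?_) a ha, ?_⟩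
  · rw [one_apply_eq_self]
    rw [inner_self_eq_ofReal]
    exact Complex.zero_le_real.2 (by positivity)
  · rw [vectorFunctional_apply, map_one, one_apply_eq_self,
      one_apply_eq_self, inner_self_eq_norm_sq_to_K, hη]
    simp

/-- The vector states of an irreducible representation are pure: a state that occurs in a convex
decomposition is implemented by an intertwiner `V`, and `V* V` is a scalar. -/
lemma HasTrivialCommutant.vectorFunctional_mem_extremePoints (hπ : HasTrivialCommutant π) {η : K}
    (hη : ‖η‖ = 1) : vectorFunctional π η 1 ∈ (stateSpace A).extremePoints ℝ := by
  have hη0 : η ≠ 0 := norm_ne_zero_iff.1 (by rw [hη]; exact one_ne_zero)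
  refine mem_extremePoints_iff_left.2 ⟨vectorFunctional_one_mem_stateSpace hη, ?_⟩
  rintro φ hφ ψ hψ ⟨s, t, hs, ht, -, hst⟩
  let f : A →ₚ[ℂ] ℂ := PositiveLinearMap.mk₀ φ.toLinearMap hφ.1
  have hf (a : A) : f a = φ a := rfl
  let ξ : f.GNS := ((f.toPreGNS 1 : f.PreGNS) : f.GNS)
  have hξ (a : A) : ⟪ξ, f.gnsStarAlgHom a ξ⟫_ℂ = φ a := gns_inner f a
  have hbound (a : A) : ‖f.gnsStarAlgHom a ξ‖ ≤ √(s⁻¹) * ‖π a η‖ := by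
    rw [← pow_le_pow_iff_left₀ (norm_nonneg _) (by positivity) two_ne_zero, mul_pow,
      Real.sq_sqrt (by positivity), ← inner_self_eq_norm_sq (𝕜 := ℂ), inner_rep_rep, hξ]
    have h1 : s * (φ (star a * a)).re + t * (ψ (star a * a)).re = ‖π a η‖ ^ 2 := by
      have h2 := congrArg Complex.re (congrArg (fun χ : StrongDual ℂ A => χ (star a * a)) hst)
      rw [vectorFunctional_star_mul (fun a x => rfl), one_apply_eq_self] at h2
      rw [← inner_self_eq_norm_sq (𝕜 := ℂ)]
      refine Eq.trans ?_ h2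
      rw [add_apply, smul_apply, smul_apply, Complex.add_re, Complex.real_smul, Complex.real_smul,
        Complex.re_ofReal_mul, Complex.re_ofReal_mul]
    have h3 : 0 ≤ (ψ (star a * a)).re := (Complex.nonneg_iff.1 (hψ.1 _ (star_mul_self_nonneg a))).1
    have h4 : 0 ≤ t * (ψ (star a * a)).re := by positivity
    change (φ (star a * a)).re ≤ _
    rw [inv_mul_eq_div, le_div_iff₀ hs]
    linarith
  obtain ⟨V, hVη, hV⟩ := exists_intertwiner_of_norm_le (hπ.denseRange hη0) hbound
  obtain ⟨c, hc⟩ := hπ (V.adjoint ∘L V) fun a x => by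
    simp only [ContinuousLinearMap.comp_apply, hV, adjoint_intertwines hV]
  have hφc (a : A) : φ a = c * vectorFunctional π η 1 a := by
    rw [← hξ, ← hVη, ← hV, ← ContinuousLinearMap.adjoint_inner_right,
      ← ContinuousLinearMap.comp_apply, hc, inner_smul_right]
    rfl
  have hc1 : c = 1 := by
    have h := hφc 1
    rw [hφ.2, (vectorFunctional_one_mem_stateSpace hη).2, mul_one] at h
    exact h.symm
  ext a
  rw [hφc, hc1, one_mul]

/-- The vector state of a unit vector in an irreducible representation, as a pure state. -/
def HasTrivialCommutant.vectorState (hπ : HasTrivialCommutant π) {η : K} (hη : ‖η‖ = 1) :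
    PureState A :=
  ⟨vectorFunctional π η 1, hπ.vectorFunctional_mem_extremePoints hη⟩

lemma HasTrivialCommutant.vectorState_apply (hπ : HasTrivialCommutant π) {η : K} (hη : ‖η‖ = 1)
    (a : A) : (hπ.vectorState hη).1 a = ⟪η, π a η⟫_ℂ := rfl

/-- The GNS representation of a vector state of an irreducible representation is unitarily
equivalent to that representation. -/
lemma HasTrivialCommutant.exists_unitary_vectorState (hπ : HasTrivialCommutant π) {η : K}
    (hη : ‖η‖ = 1) : ∃ U : K ≃ₗᵢ[ℂ] (hπ.vectorState hη).Space,
      ∀ a x, U (π a x) = (hπ.vectorState hη).rep a (U x) := by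
  have hη0 : η ≠ 0 := norm_ne_zero_iff.1 (by rw [hη]; exact one_ne_zero)
  obtain ⟨V, hVη, hV⟩ := exists_intertwiner_of_norm_le (π' := (hπ.vectorState hη).rep)
    (η' := (hπ.vectorState hη).cyclic) (C := 1) (hπ.denseRange hη0) fun a => by
      rw [one_mul, ← pow_le_pow_iff_left₀ (norm_nonneg _) (norm_nonneg _) two_ne_zero,
        ← inner_self_eq_norm_sq (𝕜 := ℂ), ← inner_self_eq_norm_sq (𝕜 := ℂ), inner_rep_rep,
        inner_rep_rep, PureState.inner_cyclic, hπ.vectorState_apply]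
  exact exists_unitary_of_intertwiner hπ (PureState.hasTrivialCommutant _) hV
    (by rw [hVη]; exact PureState.cyclic_ne_zero _)

end VectorStates

end PureStates

/-! ### Block diagonal operators -/

section BlockDiagonal

variable {ι : Type*} {H : ι → Type*} [∀ α, NormedAddCommGroup (H α)]
  [∀ α, InnerProductSpace ℂ (H α)]

/-- The block diagonal operator on the Hilbert space direct sum `⊕_α ℋ_α` defined by a bounded
family of operators. -/
def diagOp (B : DirectSumB H) : lp H 2 →L[ℂ] lp H 2 :=
  LinearMap.mkContinuous
    { toFun := fun x => ⟨fun α => B α (x α), ((lp.memℓp x).norm.const_mul ‖B‖).mono fun α => by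
        refine ((B α).le_opNorm (x α)).trans ?_
        simpa using mul_le_mul_of_nonneg_right
          (lp.norm_apply_le_norm ENNReal.top_ne_zero B α) (norm_nonneg (x α))⟩
      map_add' := fun x y => by ext α : 2; exact map_add _ _ _
      map_smul' := fun c x => by ext α : 2; exact map_smul (B α) c (x α) }
    ‖B‖ fun x => by
      have h : ‖B‖ * ‖x‖ = ‖(‖B‖ : ℂ) • x‖ := by rw [norm_smul]; simp
      rw [h]
      refine lp.norm_mono two_ne_zero fun α => ?_
      refine ((B α).le_opNorm (x α)).trans ?_
      rw [lp.coeFn_smul, Pi.smul_apply, norm_smul]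
      simpa using mul_le_mul_of_nonneg_right
        (lp.norm_apply_le_norm ENNReal.top_ne_zero B α) (norm_nonneg (x α))

lemma diagOp_apply (B : DirectSumB H) (x : lp H 2) (α : ι) : diagOp B x α = B α (x α) := rfl

lemma norm_diagOp_le (B : DirectSumB H) : ‖diagOp B‖ ≤ ‖B‖ :=
  LinearMap.mkContinuous_norm_le _ (norm_nonneg _) _

lemma inner_single_diagOp [DecidableEq ι] (B : DirectSumB H) (α : ι) (x : H α) :
    ⟪lp.single 2 α x, diagOp B (lp.single 2 α x)⟫_ℂ = ⟪x, B α x⟫_ℂ := by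
  rw [lp.inner_single_left, diagOp_apply, lp.single_apply_self]

/-- An operator whose off-diagonal blocks vanish acts componentwise. -/
lemma apply_eq_of_offDiagonal_eq_zero [DecidableEq ι] {T : lp H 2 →L[ℂ] lp H 2}
    (hT : ∀ α β (x : H α), β ≠ α → T (lp.single 2 α x) β = 0) (x : lp H 2) (β : ι) :
    T x β = T (lp.single 2 β (x β)) β := by
  have h1 := (lp.hasSum_single (by norm_num) x).mapL
    ((lp.evalCLM ℂ H 2 β).comp T)
  have h2 := hasSum_single β fun α hα => (hT α β (x α) hα.symm :
    ((lp.evalCLM ℂ H 2 β).comp T) (lp.single 2 α (x α)) = 0)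
  exact h1.unique h2

variable [∀ α, CompleteSpace (H α)]

lemma inner_diagOp_left (A : selfAdjoint (DirectSumB H)) (x y : lp H 2) :
    ⟪diagOp (A : DirectSumB H) x, y⟫_ℂ = ⟪x, diagOp (A : DirectSumB H) y⟫_ℂ := by
  rw [lp.inner_eq_tsum, lp.inner_eq_tsum]
  exact tsum_congr fun α => isSymmetric_apply A α (x α) (y α)

/-- A self-adjoint operator with vanishing off-diagonal blocks is given by a self-adjoint element of
`⊕_α 𝔅(ℋ_α)`. -/
lemma exists_diagOp_eq [DecidableEq ι] {T : lp H 2 →L[ℂ] lp H 2}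
    (hsym : ∀ x y, ⟪T x, y⟫_ℂ = ⟪x, T y⟫_ℂ)
    (hT : ∀ α β (x : H α), β ≠ α → T (lp.single 2 α x) β = 0) :
    ∃ A : selfAdjoint (DirectSumB H), diagOp (A : DirectSumB H) = T := by
  let B (α : ι) : H α →L[ℂ] H α :=
    (lp.evalCLM ℂ H 2 α).comp (T.comp (lp.singleContinuousLinearMap ℂ H 2 α))
  have hB (α : ι) (x : H α) : B α x = T (lp.single 2 α x) α := rfl
  have hbound (α : ι) : ‖B α‖ ≤ ‖T‖ := by
    refine ContinuousLinearMap.opNorm_le_bound _ (norm_nonneg _) fun x => ?_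
    rw [hB]
    refine (lp.norm_apply_le_norm two_ne_zero _ α).trans ((T.le_opNorm _).trans_eq ?_)
    rw [lp.norm_single (by norm_num)]
  have hsa (α : ι) : IsSelfAdjoint (B α) := by
    refine ContinuousLinearMap.isSelfAdjoint_iff_isSymmetric.2 fun x y => ?_
    change ⟪T (lp.single 2 α x) α, y⟫_ℂ = ⟪x, T (lp.single 2 α y) α⟫_ℂ
    rw [← lp.inner_single_left, ← lp.inner_single_right, hsym]
  let A : DirectSumB H := ⟨B, memℓp_infty ⟨‖T‖, by rintro _ ⟨α, rfl⟩; exact hbound α⟩⟩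
  have hA : IsSelfAdjoint A := lp.ext (funext fun α => hsa α)
  refine ⟨⟨A, hA⟩, ?_⟩
  ext x β
  exact (apply_eq_of_offDiagonal_eq_zero hT x β).symm

end BlockDiagonal

/-! ### The weak closure of the reduced atomic representation -/

section Density

variable {A : Type*} [CStarAlgebra A] [PartialOrder A] [StarOrderedRing A]

/-- The reduced atomic representation as a star algebra homomorphism. -/
def reducedAtomicHom : A →⋆ₐ[ℂ] (HRa A →L[ℂ] HRa A) where
  toFun := reducedAtomic
  map_one' := by ext x q : 3; simp [reducedAtomic_apply]
  map_mul' a b := by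
    ext x q : 3
    change q.repr.rep (a * b) (x q) = q.repr.rep a (q.repr.rep b (x q))
    rw [map_mul, mul_apply_eq_comp]
  map_zero' := by
    ext x q : 3
    change q.repr.rep 0 (x q) = 0
    rw [map_zero, zero_apply]
  map_add' a b := by
    ext x q : 3
    change q.repr.rep (a + b) (x q) = q.repr.rep a (x q) + q.repr.rep b (x q)
    rw [map_add, add_apply]
  commutes' c := by
    ext x q : 3
    change q.repr.rep (algebraMap ℂ A c) (x q) = c • x q
    rw [AlgHomClass.commutes, ContinuousLinearMap.algebraMap_apply]
  map_star' a := by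
    rw [ContinuousLinearMap.star_eq_adjoint, ContinuousLinearMap.eq_adjoint_iff]
    intro x y
    rw [lp.inner_eq_tsum, lp.inner_eq_tsum]
    refine tsum_congr fun q => ?_
    change ⟪q.repr.rep (star a) (x q), y q⟫_ℂ = ⟪x q, q.repr.rep a (y q)⟫_ℂ
    rw [inner_rep_left, star_star]

lemma reducedAtomicHom_apply (a : A) : reducedAtomicHom a = reducedAtomic a := rfl

open Classical in
lemma reducedAtomic_single (a : A) (q : Sector A) (x : q.repr.Space) :
    reducedAtomic a (lp.single 2 q x) = lp.single 2 q (q.repr.rep a x) := by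
  ext r : 2
  rw [reducedAtomic_apply]
  by_cases h : r = q
  · subst h
    rw [lp.single_apply_self, lp.single_apply_self]
  · rw [lp.single_apply_ne _ _ _ h, lp.single_apply_ne _ _ _ h, map_zero]

open Classical in
/-- The commutant of the reduced atomic representation consists of the operators that act as a
scalar on each summand, by Schur's lemma: the summands are irreducible and pairwise inequivalent. -/
lemma exists_apply_eq_smul_of_commute {T : HRa A →L[ℂ] HRa A}
    (hT : ∀ a x, T (reducedAtomic a x) = reducedAtomic a (T x)) :
    ∃ c : Sector A → ℂ, ∀ x q, T x q = c q • x q := by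
  let B (q r : Sector A) : q.repr.Space →L[ℂ] r.repr.Space :=
    (lp.evalCLM ℂ _ 2 r).comp (T.comp (lp.singleContinuousLinearMap ℂ _ 2 q))
  have hB (q r : Sector A) (x : q.repr.Space) : B q r x = T (lp.single 2 q x) r := rfl
  have hint (q r : Sector A) (a : A) (x : q.repr.Space) :
      B q r (q.repr.rep a x) = r.repr.rep a (B q r x) := by
    rw [hB, hB, ← reducedAtomic_single, hT, reducedAtomic_apply]
  have hoff (q r : Sector A) (x : q.repr.Space) (hrq : r ≠ q) : T (lp.single 2 q x) r = 0 := by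
    by_contra h
    have hequiv : q.repr ≈ r.repr := exists_unitary_of_intertwiner
      (PureState.hasTrivialCommutant _) (PureState.hasTrivialCommutant _) (hint q r) (x₀ := x) h
    have := Quotient.sound hequiv
    rw [Sector.repr, Sector.repr, Quotient.out_eq, Quotient.out_eq] at this
    exact hrq this.symm
  choose c hc using fun q => PureState.hasTrivialCommutant _ (B q q) (hint q q)
  refine ⟨c, fun x q => ?_⟩
  rw [apply_eq_of_offDiagonal_eq_zero hoff, ← hB, hc]

/-- Block diagonal operators commute with the commutant of the reduced atomic representation. -/
lemma diagOp_comm {T : HRa A →L[ℂ] HRa A}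
    (hT : ∀ a x, T (reducedAtomic a x) = reducedAtomic a (T x))
    (B : DirectSumB fun q : Sector A => q.repr.Space) (x : HRa A) :
    T (diagOp B x) = diagOp B (T x) := by
  obtain ⟨c, hc⟩ := exists_apply_eq_smul_of_commute hT
  ext q : 2
  rw [hc, diagOp_apply, diagOp_apply, hc, map_smul]

end Density

/-! ### Amplifications -/

section Amplification

variable {K : Type*} [NormedAddCommGroup K] [InnerProductSpace ℂ K] (κ : Type*)

/-- The operator `T ⊕ ⋯ ⊕ T` on a finite Hilbert space direct sum of copies of a Hilbert space. -/
def amplify (T : K →L[ℂ] K) : PiLp 2 (fun _ : κ => K) →L[ℂ] PiLp 2 (fun _ : κ => K) :=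
  ((PiLp.continuousLinearEquiv 2 ℂ (fun _ : κ => K)).symm : (κ → K) →L[ℂ] _).comp
    ((ContinuousLinearMap.pi fun i => T.comp (ContinuousLinearMap.proj i)).comp
      ((PiLp.continuousLinearEquiv 2 ℂ (fun _ : κ => K)) : _ →L[ℂ] (κ → K)))

variable {κ}

lemma amplify_apply (T : K →L[ℂ] K) (x : PiLp 2 (fun _ : κ => K)) (i : κ) :
    amplify κ T x i = T (x i) := rfl

variable [Fintype κ] [CompleteSpace K] {A : Type*} [CStarAlgebra A]

variable (κ) in
/-- The direct sum of copies of a representation. -/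
def amplifyHom (π : A →⋆ₐ[ℂ] (K →L[ℂ] K)) :
    A →⋆ₐ[ℂ] (PiLp 2 (fun _ : κ => K) →L[ℂ] PiLp 2 (fun _ : κ => K)) where
  toFun a := amplify κ (π a)
  map_one' := by ext x i; simp [amplify_apply]
  map_mul' a b := by ext x i; simp [amplify_apply]
  map_zero' := by ext x i; simp [amplify_apply]
  map_add' a b := by ext x i; simp [amplify_apply]
  commutes' c := by
    ext x i
    rw [amplify_apply, AlgHomClass.commutes]
    rfl
  map_star' a := by
    rw [ContinuousLinearMap.star_eq_adjoint, ContinuousLinearMap.eq_adjoint_iff]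
    intro x y
    rw [PiLp.inner_apply, PiLp.inner_apply]
    refine Finset.sum_congr rfl fun i _ => ?_
    rw [amplify_apply, amplify_apply, inner_rep_left, star_star]

lemma amplifyHom_apply (π : A →⋆ₐ[ℂ] (K →L[ℂ] K)) (a : A) (x : PiLp 2 (fun _ : κ => K)) (i : κ) :
    amplifyHom κ π a x i = π a (x i) := rfl

/-- The density part of the **double commutant theorem**: an operator that commutes with the
commutant of a representation can be approximated by the representation on finitely many vectors.
The orbit closure of the tuple of vectors in an amplification is reducing, and the entries of the
projection onto it lie in the commutant. -/
lemma exists_norm_rep_sub_lt (π : A →⋆ₐ[ℂ] (K →L[ℂ] K)) {B : K →L[ℂ] K}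
    (hB : ∀ T : K →L[ℂ] K, (∀ a x, T (π a x) = π a (T x)) → ∀ x, T (B x) = B (T x))
    (x : κ → K) {ε : ℝ} (hε : 0 < ε) : ∃ a, ∀ i, ‖π a (x i) - B (x i)‖ < ε := by
  classical
  let X : PiLp 2 (fun _ : κ => K) := WithLp.toLp 2 x
  let Q := (orbitClosure (amplifyHom κ π) X).starProjection
  have hQ (a : A) (y : PiLp 2 (fun _ : κ => K)) :
      Q (amplifyHom κ π a y) = amplifyHom κ π a (Q y) :=
    starProjection_orbitClosure_comm _ _ _ _
  let incl (j : κ) : K →L[ℂ] PiLp 2 (fun _ : κ => K) :=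
    ((PiLp.continuousLinearEquiv 2 ℂ (fun _ : κ => K)).symm : (κ → K) →L[ℂ] _).comp
      (ContinuousLinearMap.single ℂ (fun _ : κ => K) j)
  have hincl (T : K →L[ℂ] K) (j : κ) (y : K) : amplify κ T (incl j y) = incl j (T y) := by
    ext i
    change T (Pi.single (M := fun _ : κ => K) j y i) = Pi.single (M := fun _ : κ => K) j (T y) i
    by_cases h : i = j
    · subst h; simp
    · simp [h]
  have hsum (y : PiLp 2 (fun _ : κ => K)) : y = ∑ j, incl j (y j) := by
    apply (PiLp.continuousLinearEquiv 2 ℂ (fun _ : κ => K)).injective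
    rw [map_sum]
    exact (Finset.univ_sum_single (M := fun _ : κ => K) (fun j => y j)).symm
  let entry (i j : κ) : K →L[ℂ] K := (PiLp.proj 2 (fun _ : κ => K) i).comp (Q.comp (incl j))
  have hentry (i j : κ) (y : K) : entry i j y = Q (incl j y) i := rfl
  have hcomm (i j : κ) (y : K) : entry i j (B y) = B (entry i j y) := by
    refine hB _ (fun a y => ?_) y
    rw [hentry, hentry, ← hincl]
    change Q (amplifyHom κ π a (incl j y)) i = _
    rw [hQ, amplifyHom_apply]
  have hQB (y : PiLp 2 (fun _ : κ => K)) : Q (amplify κ B y) = amplify κ B (Q y) := by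
    have h1 : Q (amplify κ B y) = ∑ j, Q (incl j (B (y j))) := by
      conv_lhs => rw [hsum (amplify κ B y), map_sum]
      rfl
    have h2 : amplify κ B (Q y) = ∑ j, amplify κ B (Q (incl j (y j))) := by
      conv_lhs => rw [hsum y, map_sum, map_sum]
    rw [h1, h2]
    refine Finset.sum_congr rfl fun j _ => ?_
    ext i
    exact hcomm i j (y j)
  have hmem : amplify κ B X ∈ orbitClosure (amplifyHom κ π) X := by
    refine Submodule.starProjection_eq_self_iff.1 ?_
    change Q (amplify κ B X) = _
    rw [hQB]
    exact congrArg _ (Submodule.starProjection_eq_self_iff.2 (mem_orbitClosure_self _ X))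
  rw [← SetLike.mem_coe, coe_orbitClosure] at hmem
  obtain ⟨_, ⟨a, rfl⟩, ha⟩ := Metric.mem_closure_iff.1 hmem ε hε
  refine ⟨a, fun i => ?_⟩
  rw [dist_comm, dist_eq_norm] at ha
  exact (PiLp.norm_apply_le (amplifyHom κ π a X - amplify κ B X) i).trans_lt ha

end Amplification

section WeakClosure

variable {A : Type*} [CStarAlgebra A] [PartialOrder A] [StarOrderedRing A]

lemma reducedAtomic_inner_left {a : A} (ha : IsSelfAdjoint a) (x y : HRa A) :
    ⟪reducedAtomic a x, y⟫_ℂ = ⟪x, reducedAtomic a y⟫_ℂ := by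
  have := inner_rep_left reducedAtomicHom a x y
  rwa [ha.star_eq] at this

open Classical in
/-- Operators in the weak closure are self-adjoint and block diagonal, since these conditions are
closed in the weak operator topology. -/
lemma exists_diagOp_eq_of_mem_raClosure {B : HRa A →L[ℂ] HRa A} (hB : B ∈ raClosure A) :
    ∃ C : selfAdjoint (DirectSumB fun q : Sector A => q.repr.Space),
      diagOp (C : DirectSumB fun q : Sector A => q.repr.Space) = B := by
  have hcont (x y : HRa A) : Continuous fun T : HRa A →WOT[ℂ] HRa A => ⟪x, T y⟫_ℂ :=
    ContinuousLinearMapWOT.continuous_dual_apply y (innerSL ℂ x)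
  have hclosed : IsClosed {T : HRa A →WOT[ℂ] HRa A |
      (∀ x y, (starRingEnd ℂ) ⟪y, T x⟫_ℂ = ⟪x, T y⟫_ℂ) ∧
      ∀ (q r : Sector A) (x : q.repr.Space) (y : r.repr.Space), r ≠ q →
        ⟪lp.single 2 r y, T (lp.single 2 q x)⟫_ℂ = 0} := by
    simp only [Set.ofPred_and, Set.ofPred_forall]
    refine IsClosed.inter ?_ ?_
    · exact isClosed_iInter fun x => isClosed_iInter fun y =>
        isClosed_eq (Complex.continuous_conj.comp (hcont y x)) (hcont x y)
    · exact isClosed_iInter fun q => isClosed_iInter fun r => isClosed_iInter fun x =>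
        isClosed_iInter fun y => isClosed_iInter fun _ => isClosed_eq (hcont _ _) continuous_const
  obtain ⟨h1, h2⟩ := closure_minimal (by
    rintro _ ⟨a, rfl⟩
    refine ⟨fun x y => ?_, fun q r x y hrq => ?_⟩
    · rw [inner_conj_symm]
      exact reducedAtomic_inner_left a.2 x y
    · change ⟪lp.single 2 r y, reducedAtomic (a : A) (lp.single 2 q x)⟫_ℂ = 0
      rw [reducedAtomic_single, lp.inner_single_left, lp.single_apply_ne _ _ _ hrq,
        inner_zero_right]) hclosed hB
  refine exists_diagOp_eq (fun x y => ?_) fun q r x hrq => ?_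
  · have := h1 x y
    rwa [inner_conj_symm] at this
  · refine ext_inner_left ℂ fun y => ?_
    have := h2 q r x y hrq
    rw [inner_zero_right, ← this]
    exact (lp.inner_single_left (G := fun q : Sector A => q.repr.Space) r y _).symm

/-- Self-adjoint block diagonal operators lie in the weak closure. -/
lemma diagOp_mem_raClosure (C : selfAdjoint (DirectSumB fun q : Sector A => q.repr.Space)) :
    diagOp (C : DirectSumB fun q : Sector A => q.repr.Space) ∈ raClosure A := by
  set B := diagOp (C : DirectSumB fun q : Sector A => q.repr.Space) with hB
  have hsym (x y : HRa A) : ⟪B x, y⟫_ℂ = ⟪x, B y⟫_ℂ := inner_diagOp_left C x y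
  change ContinuousLinearMapWOT.ofCLM B ∈ closure _
  rw [mem_closure_iff_nhds_basis
    ((ContinuousLinearMapWOT.withSeminorms (σ := RingHom.id ℂ) (E := HRa A)
      (F := HRa A)).hasBasis_ball (x := ContinuousLinearMapWOT.ofCLM B))]
  rintro ⟨s, r⟩ hr
  simp only at hr
  let rep (i : HRa A × StrongDual ℂ (HRa A)) : HRa A := (InnerProductSpace.toDual ℂ (HRa A)).symm i.2
  let M : ℝ := 1 + ∑ i ∈ s, (‖rep i‖ + ‖i.1‖)
  have hM : 0 < M := by positivity
  have hMi (i) (hi : i ∈ s) : ‖rep i‖ + ‖i.1‖ < M := by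
    have := Finset.single_le_sum (f := fun i => ‖rep i‖ + ‖i.1‖)
      (fun i _ => by positivity) hi
    linarith
  -- approximate on the vectors of the neighbourhood and on those representing its functionals
  obtain ⟨b, hb⟩ := exists_norm_rep_sub_lt (κ := s ⊕ s) reducedAtomicHom (B := B)
    (fun T hT x => diagOp_comm hT _ x) (Sum.elim (fun i => i.1.1) fun i => rep i.1)
    (show 0 < r / M by positivity)
  simp only [reducedAtomicHom_apply] at hb
  -- the real part of `b` approximates `B` weakly, since `B` is self-adjoint
  let a : A := (1 / 2 : ℂ) • (b + star b)
  have ha : IsSelfAdjoint a := by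
    have h : star (1 / 2 : ℂ) = 1 / 2 := by simp
    rw [IsSelfAdjoint, star_smul, star_add, star_star, add_comm, h]
  refine ⟨_, ⟨⟨a, ha⟩, rfl⟩, ?_⟩
  rw [Seminorm.mem_ball]
  refine Seminorm.finset_sup_apply_lt hr fun i hi => ?_
  have hval : i.2 ((reducedAtomic a - B) i.1) =
      (1 / 2 : ℂ) * (⟪rep i, reducedAtomic b i.1 - B i.1⟫_ℂ +
        ⟪reducedAtomic b (rep i) - B (rep i), i.1⟫_ℂ) := by
    have h1 : i.2 ((reducedAtomic a - B) i.1) = ⟪rep i, (reducedAtomic a - B) i.1⟫_ℂ :=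
      (InnerProductSpace.toDual_symm_apply).symm
    have h2 : reducedAtomic a i.1 = (1 / 2 : ℂ) • (reducedAtomic b i.1 +
        reducedAtomic (star b) i.1) := by
      rw [← reducedAtomicHom_apply, map_smul, map_add]
      rfl
    have h3 : ⟪rep i, reducedAtomic (star b) i.1⟫_ℂ = ⟪reducedAtomic b (rep i), i.1⟫_ℂ :=
      (inner_rep_left reducedAtomicHom b _ _).symm
    rw [h1, sub_apply, h2, inner_sub_right, inner_smul_right, inner_add_right, h3, inner_sub_right,
      inner_sub_left, hsym]
    ring
  change ‖i.2 ((reducedAtomic a - B) i.1)‖ < r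
  rw [hval, norm_mul]
  have h1 : ‖⟪rep i, reducedAtomic b i.1 - B i.1⟫_ℂ‖ ≤ ‖rep i‖ * (r / M) :=
    (norm_inner_le_norm _ _).trans (by gcongr; exact (hb (Sum.inl ⟨i, hi⟩)).le)
  have h2 : ‖⟪reducedAtomic b (rep i) - B (rep i), i.1⟫_ℂ‖ ≤ r / M * ‖i.1‖ :=
    (norm_inner_le_norm _ _).trans (by gcongr; exact (hb (Sum.inr ⟨i, hi⟩)).le)
  have h3 : (‖rep i‖ + ‖i.1‖) * (r / M) < r := by
    rw [mul_div_assoc', div_lt_iff₀ hM, mul_comm]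
    exact mul_lt_mul_of_pos_left (hMi i hi) hr
  have h4 := norm_add_le ⟪rep i, reducedAtomic b i.1 - B i.1⟫_ℂ
    ⟪reducedAtomic b (rep i) - B (rep i), i.1⟫_ℂ
  have h5 : ‖(1 / 2 : ℂ)‖ = 1 / 2 := by simp
  rw [h5]
  nlinarith

/-- The weak closure of the reduced atomic representation consists of the self-adjoint block
diagonal operators. -/
lemma raClosure_eq_range : raClosure A =
    Set.range fun C : selfAdjoint (DirectSumB fun q : Sector A => q.repr.Space) =>
      diagOp (C : DirectSumB fun q : Sector A => q.repr.Space) := by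
  ext B
  constructor
  · exact fun hB => exists_diagOp_eq_of_mem_raClosure hB
  · rintro ⟨C, rfl⟩
    exact diagOp_mem_raClosure C

end WeakClosure

/-! ### Pure states as rays of the reduced atomic representation -/

section PureStateRays

variable {A : Type*} [CStarAlgebra A] [PartialOrder A] [StarOrderedRing A]

/-- The component of `Ω_ρ` in the summand of the reduced atomic representation that is equivalent to
the GNS representation of `ρ`. -/
def omegaComponent (ρ : PureState A) : (Sector.repr (⟦ρ⟧ : Sector A)).Space :=
  (exists_intertwiner ρ).choose ρ.cyclic

open Classical in
lemma omega_eq_single (ρ : PureState A) :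
    omega ρ = lp.single 2 (⟦ρ⟧ : Sector A) (omegaComponent ρ) := by
  rw [omega, omegaComponent]

lemma norm_omegaComponent (ρ : PureState A) : ‖omegaComponent ρ‖ = 1 := by
  rw [omegaComponent, LinearIsometryEquiv.norm_map, PureState.norm_cyclic]

lemma omegaComponent_ne_zero (ρ : PureState A) : omegaComponent ρ ≠ 0 :=
  norm_ne_zero_iff.1 (by rw [norm_omegaComponent]; exact one_ne_zero)

lemma inner_omegaComponent (ρ : PureState A) (a : A) :
    ⟪omegaComponent ρ, (Sector.repr (⟦ρ⟧ : Sector A)).rep a (omegaComponent ρ)⟫_ℂ = ρ.1 a := by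
  rw [omegaComponent, ← (exists_intertwiner ρ).choose_spec, LinearIsometryEquiv.inner_map_map,
    PureState.inner_cyclic]

/-- The ray of `Ω_ρ`, as a point of the disjoint union of the projective spaces of the summands of
the reduced atomic representation. -/
def toRay (ρ : PureState A) : ProjUnion fun q : Sector A => q.repr.Space :=
  ⟨⟦ρ⟧, Projectivization.mk ℂ (omegaComponent ρ) (omegaComponent_ne_zero ρ)⟩

lemma mk_eq_mk_iff_of_norm_one {q r : Sector A} {x : q.repr.Space} {y : r.repr.Space}
    (hx : x ≠ 0) (hy : y ≠ 0) (hx1 : ‖x‖ = 1) (hy1 : ‖y‖ = 1) :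
    ((⟨q, Projectivization.mk ℂ x hx⟩ : ProjUnion fun q : Sector A => q.repr.Space) =
      ⟨r, Projectivization.mk ℂ y hy⟩) ↔
    q = r ∧ ∀ a, ⟪x, q.repr.rep a x⟫_ℂ = ⟪y, r.repr.rep a y⟫_ℂ := by
  constructor
  · intro h
    obtain ⟨rfl, h⟩ := Sigma.mk.inj_iff.1 h
    obtain ⟨c, rfl⟩ := (Projectivization.mk_eq_mk_iff' ℂ _ _ _ _).1 (eq_of_heq h)
    refine ⟨rfl, fun a => ?_⟩
    rw [norm_smul, hy1, mul_one] at hx1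
    rw [map_smul, inner_smul_left, inner_smul_right, ← mul_assoc, Complex.conj_mul', hx1]
    simp
  · rintro ⟨rfl, h⟩
    obtain ⟨c, hc⟩ := (PureState.hasTrivialCommutant q.repr).exists_smul_eq hy fun a => (h a).symm
    congr 1
    exact (Projectivization.mk_eq_mk_iff' ℂ _ _ _ _).2 ⟨c, hc⟩

lemma toRay_injective : Function.Injective (toRay (A := A)) := by
  intro ρ σ h
  have h1 := ((mk_eq_mk_iff_of_norm_one _ _ (norm_omegaComponent ρ)
    (norm_omegaComponent σ)).1 h).2
  refine Subtype.ext (ContinuousLinearMap.ext fun a => ?_)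
  rw [← inner_omegaComponent, h1, inner_omegaComponent]

/-- Every ray in a summand comes from a pure state, namely from its vector state. -/
lemma toRay_surjective : Function.Surjective (toRay (A := A)) := by
  rintro ⟨q, z⟩
  induction z using Projectivization.ind with
  | h v hv =>
  have hv0 : ‖v‖ ≠ 0 := norm_ne_zero_iff.2 hv
  have hc : ((‖v‖⁻¹ : ℝ) : ℂ) ≠ 0 := by exact_mod_cast inv_ne_zero hv0
  set η : q.repr.Space := ((‖v‖⁻¹ : ℝ) : ℂ) • v with hη
  have hη1 : ‖η‖ = 1 := by
    rw [hη, norm_smul, Complex.norm_real, norm_inv, norm_norm, inv_mul_cancel₀ hv0]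
  have hη0 : η ≠ 0 := smul_ne_zero hc hv
  have hvη : Projectivization.mk ℂ v hv = Projectivization.mk ℂ η hη0 :=
    ((Projectivization.mk_eq_mk_iff' ℂ _ _ _ _).2 ⟨_, rfl⟩).symm
  have hirr := PureState.hasTrivialCommutant q.repr
  refine ⟨hirr.vectorState hη1, ?_⟩
  have hequiv : q.repr ≈ hirr.vectorState hη1 := hirr.exists_unitary_vectorState hη1
  have hq : (⟦hirr.vectorState hη1⟧ : Sector A) = q := by
    rw [← Quotient.sound hequiv, Sector.repr, Quotient.out_eq]
  rw [hvη, toRay, mk_eq_mk_iff_of_norm_one _ _ (norm_omegaComponent _) hη1]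
  exact ⟨hq, fun a => by rw [inner_omegaComponent, hirr.vectorState_apply]⟩

variable (A) in
/-- The identification of the pure state space with the disjoint union of the projective spaces of
the summands of the reduced atomic representation. -/
def rayEquiv : PureState A ≃ ProjUnion fun q : Sector A => q.repr.Space :=
  Equiv.ofBijective toRay ⟨toRay_injective, toRay_surjective⟩

open Classical in
lemma projProb_mk_mk {ι : Type*} {H : ι → Type*} [∀ α, NormedAddCommGroup (H α)]
    [∀ α, InnerProductSpace ℂ (H α)] {α β : ι} {x : H α} {y : H β} (hx : x ≠ 0) (hy : y ≠ 0)
    (hx1 : ‖x‖ = 1) (hy1 : ‖y‖ = 1) :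
    (projProb H ⟨α, Projectivization.mk ℂ x hx⟩ ⟨β, Projectivization.mk ℂ y hy⟩ : ℝ) =
      if α = β then ‖⟪lp.single 2 α x, lp.single (E := H) 2 β y⟫_ℂ‖ ^ 2 else 0 := by
  by_cases h : α = β
  · subst h
    rw [if_pos rfl, projProb_same, rayProb_mk, hx1, hy1, mul_one, div_one, lp.inner_single_left,
      lp.single_apply_self]
  · simp [projProb, h]

lemma pureProb_eq (ρ σ : PureState A) :
    pureProb ρ σ = projProb (fun q : Sector A => q.repr.Space) (rayEquiv A ρ) (rayEquiv A σ) := by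
  classical
  refine Subtype.ext ?_
  refine Eq.trans ?_ (projProb_mk_mk (H := fun q : Sector A => q.repr.Space)
    (omegaComponent_ne_zero ρ) (omegaComponent_ne_zero σ) (norm_omegaComponent ρ)
    (norm_omegaComponent σ)).symm
  rw [pureProb]
  by_cases h : ρ ≈ σ
  · rw [if_pos h, if_pos (Quotient.sound h)]
    change ‖⟪omega ρ, omega σ⟫_ℂ‖ ^ 2 = _
    rw [omega_eq_single, omega_eq_single]
    congr!
  · rw [if_neg h, if_neg (fun h' => h (Quotient.exact h'))]
    rfl

/-- The block diagonal operator on the space of the reduced atomic representation defined by a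
self-adjoint element of the direct sum of the operator algebras of its summands. -/
def blockOp (C : selfAdjoint (DirectSumB fun q : Sector A => q.repr.Space)) : HRa A →L[ℂ] HRa A :=
  diagOp (H := fun q : Sector A => q.repr.Space) C.1

/-- The Gelfand transform of a block diagonal operator is the function of the corresponding element
of the direct sum of operator algebras. -/
lemma gelfandFn_blockOp (C : selfAdjoint (DirectSumB fun q : Sector A => q.repr.Space))
    (ρ : PureState A) :
    gelfandFn (blockOp C) ρ = hatFn (fun q : Sector A => q.repr.Space) C (rayEquiv A ρ) := by
  classical
  change (⟪omega ρ, blockOp C (omega ρ)⟫_ℂ).re =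
    rayState (Projectivization.mk ℂ (omegaComponent ρ) (omegaComponent_ne_zero ρ))
      (C.1 (⟦ρ⟧ : Sector A))
  rw [rayState_mk, norm_omegaComponent, one_pow, div_one, omega_eq_single, blockOp]
  exact congrArg Complex.re
    (inner_single_diagOp (H := fun q : Sector A => q.repr.Space) C.1 _ (omegaComponent ρ))

lemma norm_gelfandFn_blockOp (C : selfAdjoint (DirectSumB fun q : Sector A => q.repr.Space)) :
    ‖gelfandFn (blockOp C)‖ = ‖blockOp C‖ := by
  refine le_antisymm ?_ ?_
  · refine lp.norm_le_of_forall_le (blockOp C).opNorm_nonneg fun ρ => ?_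
    refine (Complex.abs_re_le_norm _).trans ((norm_inner_le_norm _ _).trans ?_)
    rw [norm_omega, one_mul]
    simpa [norm_omega] using (blockOp C).le_opNorm (omega ρ)
  · refine (norm_diagOp_le (H := fun q : Sector A => q.repr.Space) C.1).trans ?_
    refine lp.norm_le_of_forall_le (norm_nonneg _) fun q =>
      (norm_apply_le_norm_hatFn C q).trans ?_
    refine lp.norm_le_of_forall_le (norm_nonneg _) fun z => ?_
    obtain ⟨ρ, rfl⟩ := (rayEquiv A).surjective z
    rw [← gelfandFn_blockOp]
    exact lp.norm_apply_le_norm ENNReal.top_ne_zero _ ρ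

variable (A) in
lemma raClosure_eq_range_blockOp : raClosure A = Set.range (blockOp (A := A)) :=
  raClosure_eq_range

lemma dist_gelfandFn_blockOp (C D : selfAdjoint (DirectSumB fun q : Sector A => q.repr.Space)) :
    dist (gelfandFn (blockOp C)) (gelfandFn (blockOp D)) = dist (blockOp C) (blockOp D) := by
  have hsub : gelfandFn (blockOp C) - gelfandFn (blockOp D) = gelfandFn (blockOp (C - D)) := by
    refine lp.ext (funext fun ρ => ?_)
    change (⟪omega ρ, blockOp C (omega ρ)⟫_ℂ).re - (⟪omega ρ, blockOp D (omega ρ)⟫_ℂ).re =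
      (⟪omega ρ, blockOp C (omega ρ) - blockOp D (omega ρ)⟫_ℂ).re
    rw [← Complex.sub_re, ← inner_sub_right]
  rw [dist_eq_norm (E := HRa A →L[ℂ] HRa A), dist_eq_norm, hsub, norm_gelfandFn_blockOp]
  rfl

lemma isometry_gelfandFn : Isometry ((raClosure A).domRestrict (gelfandFn (A := A))) := by
  refine Isometry.of_dist_eq (α := raClosure A) fun B B' => ?_
  obtain ⟨C, hC⟩ := (raClosure_eq_range_blockOp A).le B.2
  obtain ⟨D, hD⟩ := (raClosure_eq_range_blockOp A).le B'.2
  change dist (gelfandFn B.1) (gelfandFn B'.1) = dist B.1 B'.1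
  rw [← hC, ← hD, dist_gelfandFn_blockOp]

lemma image_gelfandFn_raClosure :
    gelfandFn '' raClosure A = {f | IsForm (pull (rayEquiv A) f)} := by
  rw [raClosure_eq_range_blockOp, ← Set.range_comp]
  ext f
  constructor
  · rintro ⟨C, rfl⟩
    have h : pull (rayEquiv A) (gelfandFn (blockOp C)) =
        fun z => hatFn (fun q : Sector A => q.repr.Space) C z := by
      funext z
      rw [pull, gelfandFn_blockOp, Equiv.apply_symm_apply]
    change IsForm (pull (rayEquiv A) (gelfandFn (blockOp C)))
    rw [h]
    exact (range_hatFn (fun q : Sector A => q.repr.Space)).le ⟨C, rfl⟩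
  · intro hf
    let g : EllInfty (ProjUnion fun q : Sector A => q.repr.Space) :=
      ⟨pull (rayEquiv A) f, memℓp_infty ⟨‖f‖, by
        rintro _ ⟨z, rfl⟩
        exact abs_pull_le (rayEquiv A) f z⟩⟩
    obtain ⟨C, hC⟩ := (range_hatFn (fun q : Sector A => q.repr.Space)).ge
      (show g ∈ {f | IsForm (fun ρ => f ρ)} from hf)
    refine ⟨C, lp.ext (funext fun ρ => ?_)⟩
    refine (gelfandFn_blockOp C ρ).trans ?_
    rw [hC]
    change f ((rayEquiv A).symm (rayEquiv A ρ)) = f ρ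
    rw [Equiv.symm_apply_apply]

end PureStateRays

end TransitionProbability

end

open TransitionProbability in
theorem proposition3p4 :
    -- the disjoint union of projective Hilbert spaces
    (∀ {ι : Type*} (H : ι → Type*) [∀ α, NormedAddCommGroup (H α)]
      [∀ α, InnerProductSpace ℂ (H α)] [∀ α, CompleteSpace (H α)],
      Isometry (bidualFn (projProb H)) ∧
      Isometry (hatFn H) ∧
      Set.range (bidualFn (projProb H)) = Set.range (hatFn H)) ∧
    -- the pure state space of a unital C⋆-algebra
    (∀ (A : Type*) [CStarAlgebra A] [PartialOrder A] [StarOrderedRing A],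
      Isometry (bidualFn (pureProb (A := A))) ∧
      Isometry ((raClosure A).domRestrict (gelfandFn (A := A))) ∧
      Set.range (bidualFn (pureProb (A := A))) = gelfandFn '' raClosure A) := by
  refine ⟨fun {ι} H _ _ _ => ?_, fun A _ _ _ => ?_⟩
  · have hp : ∀ ρ σ, projProb H ρ σ =
        projProb H (Equiv.refl (ProjUnion H) ρ) (Equiv.refl (ProjUnion H) σ) := fun _ _ => rfl
    exact ⟨isometry_bidualFn hp, isometry_hatFn H,
      (range_bidualFn_eq_formSubmodule hp).trans (range_hatFn H).symm⟩
  · exact ⟨isometry_bidualFn pureProb_eq, isometry_gelfandFn,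
      (range_bidualFn_eq_formSubmodule pureProb_eq).trans image_gelfandFn_raClosure.symm⟩
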